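/- Let $M$ be a smooth ($C^\infty$, Hausdorff, second countable) manifold without boundary of finite dimension $n\ge 1$; all maps below are $C^\infty$ on their domains. Let $T^0M=M$ and $T^{r+1}M=T(T^rM)$, let $\pi_r\colon T^{r+1}M\to T^rM$ be the canonical projection, and let $p_r=\pi_0\circ\cdots\circ\pi_{r-1}\colon T^rM\to M$ (with $p_0=\mathrm{id}$). Put $T^{r+1}M\setminus 0=\{\xi\in T^{r+1}M : Dp_r(\xi)\ne 0\}$, an open set, where $D$ denotes the tangent map. For $r\ge 2$ let $\kappa_r\colon T^rM\to T^rM$ be the canonical involution, $\kappa_r(x,y,X,Y)=(x,X,y,Y)$ in the coordinates of $T^rM=TT(T^{r-2}M)$ induced by coordinates $x$ of $T^{r-2}M$. For a map $\gamma$ from an open subset of a Euclidean space to $T^rM$, $\partial_{t^j}\gamma=(\gamma,\partial\gamma/\partial t^j)$ is its partial derivative, with values in $T^{r+1}M$; for a curve $\gamma$ we write $\gamma'$. A semispray on $T^rM$ is a smooth vector field $S\colon T^{r+1}M\setminus 0\to T^{r+2}M$ with $D\pi_r\circ S=\mathrm{id}$. A geodesic of $S$ on an open interval $I$ is a smooth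 curve $\gamma\colon I\to T^rM$ with $\gamma'(t)\in T^{r+1}M\setminus0$ and $\gamma''(t)=S(\gamma'(t))$ for all $t\in I$; a curve on a compact interval is a geodesic if it extends to a geodesic on an open interval. The complete lifts of a semispray $S$ on $M$ are the semisprays $S^{(r)}$ on $T^rM$ given by $S^{(0)}=S$ and $S^{(r+1)}=D\kappa_{r+2}\circ\kappa_{r+3}\circ DS^{(r)}\circ\kappa_{r+2}$. For $k\ge1$ and an open interval $I$, a $k$-parameter geodesic variation of a geodesic $c\colon I\to M$ of $S$ is a smooth map $V\colon I\times(-\varepsilon,\varepsilon)^k\to M$, $\varepsilon>0$, such that $V(t,0)=c(t)$ for all $t\in I$ and $t\mapsto V(t,s)$ is a geodesic of $S$ for every $s\in(-\varepsilon,\varepsilon)^k$. **Theorem.** Let $S$ be a semispray on $M$ and let $r\ge1$. (i) If $V\colon I\times(-\varepsilon,\varepsilon)^k\to M$ is a $k$-parameter geodesic variation (of some geodesic of $S$), $k\ge1$, then for all indices $1\le i_1,\dots,i_r\le k$ the curve $j\colon I\to T^rM$, $$j(t)=\partial_{s^{i_1}}\cdots\partial_{s^{i_r}}V(t,s^1,\dots,s^k)\big|_{s^1=\cdots=s^k=0},$$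 is a geodesic of $S^{(r)}$. (ii) If $[a,b]$, $a\le b$, is a compact interval and $j\colon[a,b]\to T^rM$ is a geodesic of $S^{(r)}$, then there are an open interval $I^*\supset[a,b]$, an $\varepsilon>0$ and an $r$-parameter geodesic variation $V\colon I^*\times(-\varepsilon,\varepsilon)^r\to M$ (of some geodesic of $S$) such that $$j(t)=\partial_{s^{1}}\cdots\partial_{s^{r}}V(t,s^1,\dots,s^r)\big|_{s^1=\cdots=s^r=0},\qquad t\in[a,b].$$ -/

import Mathlib

open scoped Manifold ContDiff

universe u

noncomputable section

namespace JacobiLift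

/-- A finite-dimensional smooth manifold without boundary, bundled with its model, so that the
tangent bundle construction can be iterated. -/
structure Mfd where
  E : Type
  [normedAddCommGroup : NormedAddCommGroup E]
  [normedSpace : NormedSpace ℝ E]
  [finiteDimensional : FiniteDimensional ℝ E]
  H : Type
  [topologicalSpaceModel : TopologicalSpace H]
  model : ModelWithCorners ℝ E H
  [boundaryless : model.Boundaryless]
  carrier : Type u
  [topologicalSpace : TopologicalSpace carrier]
  [chartedSpace : ChartedSpace H carrier]
  [isManifold : IsManifold model ∞ carrier]

attribute [instance] Mfd.normedAddCommGroup Mfd.normedSpace Mfd.finiteDimensional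
  Mfd.topologicalSpaceModel Mfd.boundaryless Mfd.topologicalSpace Mfd.chartedSpace Mfd.isManifold

instance : CoeSort Mfd.{u} (Type u) := ⟨Mfd.carrier⟩

/-- The bundled manifold underlying a type `M` that is a smooth `n`-manifold in Mathlib's sense. -/
@[reducible]
def Mfd.of (n : ℕ) (M : Type u) [TopologicalSpace M] [ChartedSpace (EuclideanSpace ℝ (Fin n)) M]
    [IsManifold (𝓡 n) ∞ M] : Mfd.{u} where
  E := EuclideanSpace ℝ (Fin n)
  H := EuclideanSpace ℝ (Fin n)
  model := 𝓡 n
  carrier := M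

/-- The tangent bundle `TN`, as a manifold (Mathlib's `TangentBundle`). -/
@[reducible]
def Mfd.T (N : Mfd.{u}) : Mfd.{u} where
  E := N.E × N.E
  H := ModelProd N.H N.E
  model := N.model.tangent
  carrier := TangentBundle N.model N.carrier

/-- The iterated tangent bundle: `T⁰M = M` and `Tʳ⁺¹M = T(TʳM)`. -/
@[reducible]
def Mfd.iter (M : Mfd.{u}) : ℕ → Mfd.{u}
  | 0 => M
  | r + 1 => (M.iter r).T

/-- The canonical projection `TN → N`. -/
def proj (N : Mfd.{u}) : N.T → N := fun ξ => ξ.proj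

/-- The projection `TʳM → M`, the composition of the canonical projections. -/
def baseProj (M : Mfd.{u}) : (r : ℕ) → M.iter r → M
  | 0 => id
  | r + 1 => baseProj M r ∘ proj (M.iter r)

/-- The tangent map `Df : TN → TN'`, namely Mathlib's `tangentMap`. -/
def D {N N' : Mfd.{u}} (f : N → N') : N.T → N'.T := tangentMap N.model N'.model f

/-- The canonical involution of `TTN`, which is `(x, y, X, Y) ↦ (x, X, y, Y)` in the coordinates
of `TTN` induced by any chart of `N`. In Mathlib a tangent vector at a point is stored as its
coordinate vector in the preferred chart at that point, and the preferred chart of `TN` at `(x, y)`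
is the one induced by the preferred chart of `N` at `x`; so a point of `TTN` is stored as
`⟨⟨x, y⟩, (X, Y)⟩`, with `y, X, Y` coordinates induced by the preferred chart of `N` at `x`. -/
def kappa (N : Mfd.{u}) : N.T.T → N.T.T :=
  fun ξ => ⟨⟨ξ.proj.proj, (ξ.snd : N.E × N.E).1⟩, ((ξ.proj.snd, (ξ.snd : N.E × N.E).2) : N.E × N.E)⟩

/-- The slashed bundle `Tʳ⁺¹M ∖ 0`: those `ξ` in `T(TʳM)` which the tangent map of the projection
`TʳM → M` sends to a non-zero vector in `TM`. For `r = 0` these are the non-zero vectors of `TM`. -/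
def slashed (M : Mfd.{u}) (r : ℕ) : Set (M.iter r).T :=
  {ξ | (D (baseProj M r) ξ).snd ≠ 0}

/-- `S` is a semispray on `TʳM`: a smooth vector field on `Tʳ⁺¹M ∖ 0` with `Dπ ∘ S = id`, where
`π : Tʳ⁺¹M → TʳM` is the projection. The values of `S` outside of `Tʳ⁺¹M ∖ 0` are irrelevant. -/
structure IsSemispray (M : Mfd.{u}) (r : ℕ) (S : (M.iter r).T → (M.iter r).T.T) : Prop where
  smooth : ContMDiffOn (M.iter r).T.model (M.iter r).T.T.model ∞ S (slashed M r)
  proj_eq : ∀ ξ ∈ slashed M r, proj (M.iter r).T (S ξ) = ξ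
  tangent_proj_eq : ∀ ξ ∈ slashed M r, D (proj (M.iter r)) (S ξ) = ξ

/-- One step of the complete lift: `Dκ ∘ κ ∘ DS ∘ κ`. -/
def completeLift (N : Mfd.{u}) (S : N.T → N.T.T) : N.T.T → N.T.T.T :=
  D (kappa N) ∘ kappa N.T ∘ D S ∘ kappa N

/-- The iterated complete lifts `S⁽⁰⁾ = S` and `S⁽ʳ⁺¹⁾ = Dκ ∘ κ ∘ DS⁽ʳ⁾ ∘ κ`. -/
def iterLift (M : Mfd.{u}) (S : M.T → M.T.T) : (r : ℕ) → (M.iter r).T → (M.iter r).T.T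
  | 0 => S
  | r + 1 => completeLift (M.iter r) (iterLift M S r)

/-- The derivative of a map `γ : P → N` on a normed space in a direction `v`, as a map `P → TN`;
for a coordinate vector `v` it is the partial derivative. -/
def dirDeriv {P : Type} [NormedAddCommGroup P] [NormedSpace ℝ P] {N : Mfd.{u}} (v : P)
    (γ : P → N) : P → N.T :=
  fun p => ⟨γ p, mfderiv 𝓘(ℝ, P) N.model γ p v⟩

/-- The tangent `γ' : ℝ → TN` of a curve. -/
def velocity {N : Mfd.{u}} (γ : ℝ → N) : ℝ → N.T := dirDeriv (1 : ℝ) γ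

/-- A non-empty open interval, possibly unbounded. -/
def IsOpenInterval (I : Set ℝ) : Prop := IsOpen I ∧ I.OrdConnected ∧ I.Nonempty

/-- `γ : I → TʳM` is a geodesic of `S`, for an open interval `I`: it is smooth, regular, and
`γ'' = S ∘ γ'`. The values of `γ` outside of `I` are irrelevant. -/
structure IsGeodesicOn (M : Mfd.{u}) (r : ℕ) (S : (M.iter r).T → (M.iter r).T.T)
    (γ : ℝ → M.iter r) (I : Set ℝ) : Prop where
  isOpenInterval : IsOpenInterval I
  smooth : ContMDiffOn 𝓘(ℝ, ℝ) (M.iter r).model ∞ γ I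
  regular : ∀ t ∈ I, velocity γ t ∈ slashed M r
  geodesic : ∀ t ∈ I, velocity (velocity γ) t = S (velocity γ t)

/-- `γ` is a geodesic on the closed interval `[a, b]`: it extends to a geodesic on an open
interval. -/
def IsGeodesicOnIcc (M : Mfd.{u}) (r : ℕ) (S : (M.iter r).T → (M.iter r).T.T)
    (γ : ℝ → M.iter r) (a b : ℝ) : Prop :=
  ∃ (J : Set ℝ) (γ' : ℝ → M.iter r),
    Set.Icc a b ⊆ J ∧ IsGeodesicOn M r S γ' J ∧ Set.EqOn γ' γ (Set.Icc a b)

/-- The cube `(-ε, ε)ᵏ`. -/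
def cube (k : ℕ) (ε : ℝ) : Set (Fin k → ℝ) := {s | ∀ i, s i ∈ Set.Ioo (-ε) ε}

/-- `V : I × (-ε, ε)ᵏ → M` is a `k`-parameter geodesic variation of the geodesic `c : I → M`. -/
structure IsGeodesicVariation (M : Mfd.{u}) (S : M.T → M.T.T) (k : ℕ) (c : ℝ → M) (I : Set ℝ)
    (ε : ℝ) (V : ℝ × (Fin k → ℝ) → M) : Prop where
  one_le : 1 ≤ k
  eps_pos : 0 < ε
  center_geodesic : IsGeodesicOn M 0 S c I
  smooth : ContMDiffOn 𝓘(ℝ, ℝ × (Fin k → ℝ)) M.model ∞ V (I ×ˢ cube k ε)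
  center : ∀ t ∈ I, V (t, 0) = c t
  geodesic : ∀ s ∈ cube k ε, IsGeodesicOn M 0 S (fun t => V (t, s)) I

/-- The partial derivative `∂_{sⁱ}` of a map of the variables `(t, s¹, …, sᵏ)`. -/
def partialS {N : Mfd.{u}} {k : ℕ} (i : Fin k) (V : ℝ × (Fin k → ℝ) → N) :
    ℝ × (Fin k → ℝ) → N.T :=
  dirDeriv ((0, Pi.single i 1) : ℝ × (Fin k → ℝ)) V

/-- The mixed derivative `∂_{s^{i₁}} ⋯ ∂_{s^{iᵣ}} V`, with values in `TʳM`; the last index is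
applied first. -/
def mixedDeriv {M : Mfd.{u}} {k : ℕ} (V : ℝ × (Fin k → ℝ) → M) :
    (r : ℕ) → (Fin r → Fin k) → ℝ × (Fin k → ℝ) → M.iter r
  | 0, _ => V
  | r + 1, i => partialS (i 0) (mixedDeriv V r (Fin.tail i))

end JacobiLift

end

/-! Everything rests on one computation. Let g(t, s) be a family of geodesics of S. The tangent map
of f sends ∂γ to ∂(f ∘ γ), and κ exchanges two derivatives, so ∂_t∂_t∂_s g = Dκ ∂_t∂_s∂_t g = Dκ κ
∂_s∂_t∂_t g = Dκ κ DS ∂_s∂_t g = Dκ κ DS κ ∂_t∂_s g. Hence ∂_s g is a family of geodesics of the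
complete lift (`IsGeodesicFamily.paramDeriv`), and iteration gives (i).

Conversely, let j be a geodesic of the complete lift. Its projection is a geodesic of S with
velocity Dπ(j'). Choose a curve W(s) of tangent vectors with ∂_s W(0) = κ(j'(a)), let the integral
curves of S start from W(s), and project them to a variation g. Then ∂_t∂_s g = j' at t = a, so ∂_s
g = j, because the complete lift is again a semispray and its integral curves are unique. With
further parameters carried along this is `exists_geodesic_family_of_completeLift`; induction on r
(`exists_geodesic_family_of_iterLift`) gives (ii).

The analytic input is smooth dependence on initial data along a compact interval
(`exists_integral_family`). It comes from a jointly smooth local flow, found by the implicit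
function theorem for u = x + δ ∫ f ∘ u in C([0, 1], E). The facts about κ reduce to the symmetry of
second derivatives, since every point of TTN is a mixed derivative of a two-parameter map
(`exists_dirDeriv_dirDeriv_eq`). -/

namespace JacobiLift

open Set Filter Topology

/-! ### Smoothness of composition operators on spaces of continuous functions -/

section Superposition

variable {K : Type*} [TopologicalSpace K] [CompactSpace K]
  {E F : Type*} [NormedAddCommGroup E] [NormedSpace ℝ E] [NormedAddCommGroup F] [NormedSpace ℝ F]

/-- The superposition operator `u ↦ f ∘ u` on continuous functions. -/
def superposition (K : Type*) [TopologicalSpace K] (f : C(E, F)) : C(K, E) → C(K, F) :=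
  fun u => f.comp u

variable (K E F) in
/-- Pointwise application of a continuous family of operators to a continuous function. -/
noncomputable def pointwiseApply : C(K, E →L[ℝ] F) →L[ℝ] C(K, E) →L[ℝ] C(K, F) :=
  LinearMap.mkContinuous₂
    (LinearMap.mk₂ ℝ
      (fun (A : C(K, E →L[ℝ] F)) (h : C(K, E)) =>
        (⟨fun t => A t (h t), A.continuous.clm_apply h.continuous⟩ : C(K, F)))
      (fun A B h => by ext; simp) (fun c A h => by ext; simp)
      (fun A g h => by ext; simp) (fun c A h => by ext; simp)) 1
    (fun A h => by
      rw [one_mul]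
      refine (ContinuousMap.norm_le _ (by positivity)).2 fun t => ?_
      exact ((A t).le_opNorm (h t)).trans (mul_le_mul (A.norm_coe_le_norm t)
        (h.norm_coe_le_norm t) (norm_nonneg (h t)) (norm_nonneg A)))

/-- The mean value inequality on the segment from `u t` to `u t + h t` bounds the remainder. The
bound is uniform in `t` because `u ↦ f' ∘ u` is continuous for the sup norm. -/
theorem hasFDerivAt_superposition (f : C(E, F)) (f' : C(E, E →L[ℝ] F))
    (hf : ∀ x, HasFDerivAt f (f' x) x) (u : C(K, E)) :
    HasFDerivAt (superposition K f) (pointwiseApply K E F (superposition K f' u)) u := by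
  rw [hasFDerivAt_iff_isLittleO_nhds_zero, Asymptotics.isLittleO_iff]
  intro ε hε
  have hc : Continuous (superposition K f') := ContinuousMap.continuous_postcomp f'
  obtain ⟨δ, hδ, hb⟩ := Metric.continuousAt_iff.1 (hc.continuousAt (x := u)) ε hε
  filter_upwards [Metric.ball_mem_nhds (0 : C(K, E)) hδ] with h hh
  rw [mem_ball_zero_iff] at hh
  refine (ContinuousMap.norm_le _ (by positivity)).2 fun t => ?_
  have key : ∀ z ∈ segment ℝ (u t) (u t + h t), ‖f' z - f' (u t)‖ ≤ ε := by
    intro z hz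
    rw [segment_eq_image'] at hz
    obtain ⟨θ, hθ, rfl⟩ := hz
    have h1 : dist (u + θ • h) u < δ := by
      rw [dist_eq_norm, add_sub_cancel_left, norm_smul, Real.norm_of_nonneg hθ.1]
      exact (mul_le_of_le_one_left (norm_nonneg _) hθ.2).trans_lt hh
    have h2 := (ContinuousMap.norm_coe_le_norm
      (superposition K f' (u + θ • h) - superposition K f' u) t).trans
        ((dist_eq_norm _ _).symm.trans_lt (hb h1)).le
    simp only [add_sub_cancel_left]
    exact h2
  have := (convex_segment (𝕜 := ℝ) (u t) (u t + h t)).norm_image_sub_le_of_norm_hasFDerivWithin_le'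
    (f := f) (f' := f') (φ := f' (u t)) (C := ε) (fun z _ => (hf z).hasFDerivWithinAt) key
    (left_mem_segment ℝ _ _) (right_mem_segment ℝ _ _)
  rw [add_sub_cancel_left] at this
  exact this.trans (mul_le_mul_of_nonneg_left (h.norm_coe_le_norm t) hε.le)

/-- The derivative is pointwise application composed with the superposition operator of `f'`, an
operator of the same kind. The induction therefore varies `F`, and `E` shares its universe so that
`E →L[ℝ] F` is an admissible target. -/
theorem contDiff_superposition_nat {E : Type u} [NormedAddCommGroup E] [NormedSpace ℝ E] (n : ℕ) :
    ∀ {F : Type u} [NormedAddCommGroup F] [NormedSpace ℝ F] (f : C(E, F)), ContDiff ℝ n f →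
      ContDiff ℝ n (superposition K f) := by
  induction n with
  | zero =>
    intro F _ _ f _
    exact contDiff_zero.2 (ContinuousMap.continuous_postcomp f)
  | succ n ih =>
    intro F _ _ f hf
    push_cast at hf ⊢
    let f' : C(E, E →L[ℝ] F) := ⟨fderiv ℝ f, hf.continuous_fderiv (by simp)⟩
    have hd := hasFDerivAt_superposition (K := K) f f'
      (fun x => (hf.differentiable (by simp) x).hasFDerivAt)
    refine (contDiff_succ_iff_hasFDerivAt (n := n)).2
      ⟨fun u => pointwiseApply K E F (superposition K f' u), ?_, hd⟩
    exact (pointwiseApply K E F).contDiff.comp (ih f' (hf.fderiv_right le_rfl))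

theorem contDiff_superposition {E F : Type u} [NormedAddCommGroup E] [NormedSpace ℝ E]
    [NormedAddCommGroup F] [NormedSpace ℝ F] (f : C(E, F)) (hf : ContDiff ℝ ∞ f) :
    ContDiff ℝ ∞ (superposition K f) :=
  contDiff_infty.2 fun n => contDiff_superposition_nat n f (contDiff_infty.1 hf n)

end Superposition

/-! ### A smooth implicit function theorem with uniqueness -/

section Implicit

variable {X Y : Type*} [NormedAddCommGroup X] [NormedSpace ℝ X] [CompleteSpace X]
  [NormedAddCommGroup Y] [NormedSpace ℝ Y] [CompleteSpace Y]

/-- Smooth implicit function theorem, with uniqueness, for an equation whose partial derivative in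
the unknown is the identity at the base point. -/
theorem exists_smooth_implicit_function {F : X × Y → Y} (hF : ContDiff ℝ ∞ F) {x₀ : X} {y₀ : Y}
    (h0 : F (x₀, y₀) = 0) (hid : ∀ b, fderiv ℝ F (x₀, y₀) (0, b) = b) :
    ∃ (u : X → Y), ∃ A ∈ 𝓝 x₀, ∃ B ∈ 𝓝 y₀, u x₀ = y₀ ∧ ContinuousAt u x₀ ∧
      ∀ x ∈ A, ContDiffAt ℝ ∞ u x ∧ F (x, u x) = 0 ∧ ∀ y ∈ B, F (x, y) = 0 → y = u x := by
  set G : X × Y → X × Y := fun p => (p.1, F p) with hG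
  have hGs : ContDiff ℝ ∞ G := contDiff_fst.prodMk hF
  set L := fderiv ℝ F (x₀, y₀)
  have hL : ∀ a b, L (a, b) = L (a, 0) + b := fun a b => by
    conv_lhs => rw [show (a, b) = (a, (0 : Y)) + (0, b) by simp]
    rw [map_add, hid]
  -- The derivative of `G` is triangular, `(a, b) ↦ (a, L (a, 0) + b)`, hence inverted by `(a, c) ↦
  -- (a, c - L (a, 0))`.
  let G' : (X × Y) ≃L[ℝ] (X × Y) := ContinuousLinearEquiv.equivOfInverse
    ((ContinuousLinearMap.fst ℝ X Y).prod L)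
    ((ContinuousLinearMap.fst ℝ X Y).prod
      (ContinuousLinearMap.snd ℝ X Y - L.comp ((ContinuousLinearMap.inl ℝ X Y).comp
        (ContinuousLinearMap.fst ℝ X Y))))
    (fun p => by ext <;> simp [hL p.1 p.2])
    (fun p => by ext <;> simp [hL p.1 (p.2 - L (p.1, 0))])
  have hG' : HasFDerivAt G (G' : X × Y →L[ℝ] X × Y) (x₀, y₀) :=
    hasFDerivAt_fst.prodMk (hF.differentiable (by simp) _).hasFDerivAt
  let e := hGs.contDiffAt.toOpenPartialHomeomorph G hG' (by simp)
  have hmem : (x₀, y₀) ∈ e.source :=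
    ContDiffAt.mem_toOpenPartialHomeomorph_source hGs.contDiffAt hG' (by simp)
  have he : ∀ p, e p = G p := fun _ => rfl
  have hG0 : G (x₀, y₀) = (x₀, 0) := by simp [hG, h0]
  have hmem' : (x₀, (0 : Y)) ∈ e.target := by rw [← hG0]; exact e.map_source hmem
  have hsymm : e.symm (x₀, 0) = (x₀, y₀) := by
    rw [← hG0]; exact e.left_inv hmem
  -- `ContDiffAt ℝ ∞` at one point does not spread to a neighbourhood, so the inverse has to be
  -- differentiated at each nearby point, where the derivative of `G` is still invertible.
  have hev : ∀ᶠ p in 𝓝 (x₀, y₀), ∃ M : (X × Y) ≃L[ℝ] (X × Y), (M : X × Y →L[ℝ] X × Y) =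
      fderiv ℝ G p := by
    have h1 : ContinuousAt (fderiv ℝ G) (x₀, y₀) := (hGs.continuous_fderiv (by simp)).continuousAt
    have h2 := h1.preimage_mem_nhds (t := range ((↑) : ((X × Y) ≃L[ℝ] (X × Y)) → _))
      (by rw [hG'.fderiv]; exact ContinuousLinearEquiv.nhds G')
    exact h2
  obtain ⟨A₁, hA₁, B, hB, hAB⟩ := mem_nhds_prod_iff.1 (e.open_source.mem_nhds hmem)
  have hcs : ContinuousAt (fun x => e.symm (x, (0 : Y))) x₀ :=
    (e.continuousAt_symm hmem').comp (f := fun x => (x, (0 : Y))) (by fun_prop)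
  have ht : ∀ᶠ x in 𝓝 x₀, (x, (0 : Y)) ∈ e.target :=
    (show Continuous fun x : X => (x, (0 : Y)) by fun_prop).continuousAt.eventually
      (e.open_target.mem_nhds hmem')
  have hev' : ∀ᶠ x in 𝓝 x₀, ∃ M : (X × Y) ≃L[ℝ] (X × Y), (M : X × Y →L[ℝ] X × Y) =
      fderiv ℝ G (e.symm (x, 0)) := by
    rw [← hsymm] at hev
    exact hcs.eventually hev
  refine ⟨fun x => (e.symm (x, 0)).2, {x | x ∈ A₁ ∧ (x, (0 : Y)) ∈ e.target ∧
    ∃ M : (X × Y) ≃L[ℝ] (X × Y), (M : X × Y →L[ℝ] X × Y) = fderiv ℝ G (e.symm (x, 0))},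
    by filter_upwards [hA₁, ht, hev'] with x h1 h2 h3 using ⟨h1, h2, h3⟩, B, hB,
    by simp [hsymm], continuousAt_snd.comp hcs, ?_⟩
  rintro x ⟨hx1, hx2, M, hM⟩
  have hr : G (e.symm (x, 0)) = (x, 0) := e.right_inv hx2
  have hfst : (e.symm (x, 0)).1 = x := congrArg Prod.fst hr
  refine ⟨?_, ?_, ?_⟩
  · have h1 : ContDiffAt ℝ ∞ e.symm (x, 0) := e.contDiffAt_symm (f₀' := M) hx2
      (by rw [hM]; exact (hGs.differentiable (by simp) _).hasFDerivAt) hGs.contDiffAt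
    exact contDiffAt_snd.comp x (h1.comp x (f := fun x : X => (x, (0 : Y)))
      (contDiffAt_id.prodMk contDiffAt_const))
  · have h1 : F (e.symm (x, 0)) = 0 := congrArg Prod.snd hr
    rwa [show e.symm (x, 0) = (x, (e.symm (x, 0)).2) from Prod.ext hfst rfl] at h1
  · intro y hy h1
    have h2 : e (x, y) = (x, 0) := by rw [he, hG]; simp [h1]
    have h3 := e.left_inv (hAB (mk_mem_prod hx1 hy))
    rw [h2] at h3
    exact (congrArg Prod.snd h3).symm

end Implicit

/-! ### Smooth local flows in Banach spaces -/

section Flow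

variable {E : Type} [NormedAddCommGroup E] [NormedSpace ℝ E] [CompleteSpace E]

/-- The operator `u ↦ ∫₀ᵗ u` on `C([0, 1], E)`. -/
noncomputable def primitive (E : Type) [NormedAddCommGroup E] [NormedSpace ℝ E] [CompleteSpace E] :
    C(unitInterval, E) →L[ℝ] C(unitInterval, E) :=
  LinearMap.mkContinuous
    { toFun := fun u => ⟨fun t => ∫ s in (0 : ℝ)..t, IccExtend zero_le_one u s,
        (intervalIntegral.continuous_primitive
          (fun a b => (u.continuous.Icc_extend').intervalIntegrable a b) 0).comp
            continuous_subtype_val⟩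
      map_add' := fun u v => by
        ext t
        exact intervalIntegral.integral_add (u.continuous.Icc_extend'.intervalIntegrable 0 t)
          (v.continuous.Icc_extend'.intervalIntegrable 0 t)
      map_smul' := fun c u => by
        ext t
        exact intervalIntegral.integral_smul c _ } 1
    (fun u => by
      rw [one_mul]
      refine (ContinuousMap.norm_le _ (norm_nonneg _)).2 fun t => ?_
      refine (intervalIntegral.norm_integral_le_of_norm_le_const (C := ‖u‖)
        fun s _ => u.norm_coe_le_norm _).trans ?_
      rw [sub_zero, abs_of_nonneg t.2.1]
      exact mul_le_of_le_one_right (norm_nonneg _) t.2.2)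

/-- The equation `u = x + δ ∫ f ∘ u` satisfied by a solution of `u' = δ f(u)`, `u(0) = x`. -/
noncomputable def integralEquation (f : C(E, E)) :
    (ℝ × E) × C(unitInterval, E) → C(unitInterval, E) :=
  fun p => p.2 - ContinuousLinearMap.const ℝ unitInterval p.1.2 -
    p.1.1 • primitive E (superposition unitInterval f p.2)

theorem contDiff_integralEquation (f : C(E, E)) (hf : ContDiff ℝ ∞ f) :
    ContDiff ℝ ∞ (integralEquation f) := by
  refine (contDiff_snd.sub ((ContinuousLinearMap.contDiff _).comp
    (contDiff_snd.comp contDiff_fst))).sub ((contDiff_fst.comp contDiff_fst).smul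
      ((primitive E).contDiff.comp ((contDiff_superposition f hf).comp contDiff_snd)))

theorem integralEquation_eq_zero_iff (f : C(E, E)) (δ : ℝ) (x : E) (u : C(unitInterval, E)) :
    integralEquation f ((δ, x), u) = 0 ↔
      ∀ t : unitInterval, u t = x + δ • ∫ s in (0 : ℝ)..t, f (IccExtend zero_le_one u s) := by
  rw [integralEquation, sub_sub, sub_eq_zero, ContinuousMap.ext_iff]
  rfl

/-- At `δ = 0` the nonlinear term vanishes and the equation is `u - x₀`; this is the purpose of
rescaling time to `[0, 1]`. -/
theorem fderiv_integralEquation (f : C(E, E)) (hf : ContDiff ℝ ∞ f) (x₀ : E)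
    (b : C(unitInterval, E)) :
    fderiv ℝ (integralEquation f) ((0, x₀), ContinuousMap.const _ x₀) (0, b) = b := by
  set y₀ : C(unitInterval, E) := ContinuousMap.const _ x₀
  have h1 := ((contDiff_integralEquation f hf).differentiable (by simp)
    ((0, x₀), y₀)).hasFDerivAt
  have h2 : HasFDerivAt (fun y => ((0, x₀), y)) (ContinuousLinearMap.inr ℝ (ℝ × E) _) y₀ :=
    hasFDerivAt_prodMk_right _ _
  have h3 := h1.comp y₀ h2
  have h4 : HasFDerivAt (fun y => y - ContinuousLinearMap.const ℝ unitInterval x₀)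
      (ContinuousLinearMap.id ℝ C(unitInterval, E)) y₀ := (hasFDerivAt_id y₀).sub_const _
  have h5 : (integralEquation f ∘ fun y => (((0 : ℝ), x₀), y)) =
      fun y => y - ContinuousLinearMap.const ℝ unitInterval x₀ := by
    funext y; simp [integralEquation]
  rw [h5] at h3
  exact DFunLike.congr_fun (h3.unique h4) b

/-- A rescaled solution solves the rescaled equation. -/
theorem integralEquation_comp_mul (f : C(E, E)) {δ : ℝ} {x : E} {u : C(unitInterval, E)}
    (hu : integralEquation f ((δ, x), u) = 0) (s : unitInterval) :
    integralEquation f ((s * δ, x), u.comp ⟨fun t => s * t, by fun_prop⟩) = 0 := by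
  rw [integralEquation_eq_zero_iff] at hu ⊢
  intro t
  refine (hu (s * t)).trans ?_
  rw [mul_comm (s : ℝ), mul_smul]
  congr 2
  have h1 : ∫ τ in (0 : ℝ)..t, f (IccExtend zero_le_one
      (u.comp ⟨fun t => s * t, by fun_prop⟩ : C(unitInterval, E)) τ) =
      ∫ τ in (0 : ℝ)..t, f (IccExtend zero_le_one u (s * τ)) := by
    refine intervalIntegral.integral_congr fun τ hτ => ?_
    rw [uIcc_of_le t.2.1] at hτ
    have hτ1 : τ ∈ Icc (0 : ℝ) 1 := ⟨hτ.1, hτ.2.trans t.2.2⟩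
    have hτ2 : (s : ℝ) * τ ∈ Icc (0 : ℝ) 1 := unitInterval.mul_mem s.2 hτ1
    rw [IccExtend_of_mem _ _ hτ1, IccExtend_of_mem _ _ hτ2]
    rfl
  rw [h1, intervalIntegral.smul_integral_comp_mul_left
    (f := fun τ => f (IccExtend zero_le_one u τ)), mul_zero]
  rfl

/-- The local flow of a globally defined smooth vector field is smooth in time and initial value
jointly. -/
theorem exists_smooth_flow_of_contDiff {f : E → E} (hf : ContDiff ℝ ∞ f) (x₀ : E) :
    ∃ Ψ : ℝ × E → E, ∃ ρ > 0, Ψ (0, x₀) = x₀ ∧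
      ∀ t ∈ Ioo (-ρ) ρ, ∀ x ∈ Metric.ball x₀ ρ, Ψ (0, x) = x ∧ ContDiffAt ℝ ∞ Ψ (t, x) ∧
        HasDerivAt (fun t => Ψ (t, x)) (f (Ψ (t, x))) t := by
  let fc : C(E, E) := ⟨f, hf.continuous⟩
  set y₀ : C(unitInterval, E) := ContinuousMap.const _ x₀
  obtain ⟨u, A, hA, B, hB, hu0, huc, hu⟩ := exists_smooth_implicit_function
    (contDiff_integralEquation fc hf) (x₀ := (0, x₀)) (y₀ := y₀)
    ((integralEquation_eq_zero_iff fc 0 x₀ y₀).2 fun t => by simp [y₀])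
    (fderiv_integralEquation fc hf x₀)
  obtain ⟨β, hβ, hβB⟩ := Metric.mem_nhds_iff.1 hB
  have hball : ∀ᶠ p in 𝓝 ((0 : ℝ), x₀), u p ∈ Metric.ball y₀ β :=
    huc.eventually (by rw [hu0]; exact Metric.ball_mem_nhds _ hβ)
  obtain ⟨ρ, hρ, hρA⟩ := Metric.mem_nhds_iff.1 (hball.and hA)
  have hin : ∀ t ∈ Ioo (-ρ) ρ, ∀ x ∈ Metric.ball x₀ ρ,
      u (t, x) ∈ Metric.ball y₀ β ∧ (t, x) ∈ A := by
    intro t ht x hx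
    refine hρA ?_
    rw [← ball_prod_same]
    refine ⟨?_, hx⟩
    rw [Real.ball_eq_Ioo]; simpa using ht
  -- Slowing the solution for `t` down by `s` solves the equation for `s * t`. It takes no new
  -- values, so it stays in the same ball about the constant `x₀`, and uniqueness in the implicit
  -- function theorem applies.
  have hscale : ∀ t ∈ Ioo (-ρ) ρ, ∀ x ∈ Metric.ball x₀ ρ, ∀ s : unitInterval,
      u (s * t, x) 1 = u (t, x) s := by
    intro t ht x hx s
    have hst : (s : ℝ) * t ∈ Ioo (-ρ) ρ := by
      rw [mem_Ioo, ← abs_lt] at ht ⊢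
      rw [abs_mul, abs_of_nonneg s.2.1]
      exact (mul_le_of_le_one_left (abs_nonneg _) s.2.2).trans_lt ht
    have h1 := integralEquation_comp_mul fc (hu _ (hin t ht x hx).2).2.1 s
    have h2 := (hu _ (hin _ hst x hx).2).2.2 _ (hβB ?_) h1
    · rw [← h2]; simp
    · have h3 := (hin t ht x hx).1
      rw [Metric.mem_ball, ContinuousMap.dist_lt_iff hβ] at h3 ⊢
      intro τ
      exact h3 (s * τ)
  have hderiv : ∀ δ ∈ Ioo (-ρ) ρ, ∀ x ∈ Metric.ball x₀ ρ, ∀ s ∈ Icc (0 : ℝ) 1,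
      HasDerivWithinAt (fun s : ℝ => u (s * δ, x) 1) (δ • f (u (s * δ, x) 1)) (Icc 0 1) s := by
    intro δ hδ x hx s hs
    have heq := (integralEquation_eq_zero_iff fc δ x _).1 (hu _ (hin δ hδ x hx).2).2.1
    have hcont : Continuous fun τ => f (IccExtend zero_le_one (u (δ, x)) τ) :=
      hf.continuous.comp (u (δ, x)).continuous.Icc_extend'
    have h1 : HasDerivAt (fun s : ℝ => x + δ • ∫ τ in (0 : ℝ)..s,
        f (IccExtend zero_le_one (u (δ, x)) τ))
        (δ • f (IccExtend zero_le_one (u (δ, x)) s)) s :=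
      ((hcont.integral_hasStrictDerivAt 0 s).hasDerivAt.const_smul δ).const_add x
    have h2 : ∀ τ ∈ Icc (0 : ℝ) 1, u (τ * δ, x) 1 = x + δ • ∫ τ in (0 : ℝ)..τ,
        f (IccExtend zero_le_one (u (δ, x)) τ) := fun τ hτ => by
      rw [hscale δ hδ x hx ⟨τ, hτ⟩, heq]; rfl
    rw [IccExtend_of_mem _ _ hs, ← hscale δ hδ x hx ⟨s, hs⟩] at h1
    exact h1.hasDerivWithinAt.congr h2 (h2 s hs)
  -- The flow at time `t` is the endpoint of the solution with speed factor `t`, so joint smoothness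
  -- is that of the implicit function.
  refine ⟨fun p => u p 1, ρ, hρ, by simp [hu0, y₀], fun t ht x hx => ?_⟩
  have hsm : ContDiffAt ℝ ∞ (fun p => u p 1) (t, x) :=
    ((ContinuousMap.evalCLM ℝ (1 : unitInterval) : C(unitInterval, E) →L[ℝ] E).contDiff.contDiffAt
      (n := ∞)).comp (t, x) (hu _ (hin t ht x hx).2).1
  have h0 : (0 : ℝ) ∈ Ioo (-ρ) ρ := ⟨by linarith, hρ⟩
  refine ⟨?_, hsm, ?_⟩
  · have := (integralEquation_eq_zero_iff fc 0 x _).1 (hu _ (hin 0 h0 x hx).2).2.1 1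
    simpa using this
  · have hd : DifferentiableAt ℝ (fun t => u (t, x) 1) t :=
      (hsm.differentiableAt (by simp)).comp t (f := fun t : ℝ => (t, x)) (by fun_prop)
    -- The derivative in `s` only determines `δ` times the derivative in time, so `δ` must be
    -- nonzero, also at `t = 0`.
    obtain ⟨δ, hδ, hδ0, s, hs, rfl⟩ : ∃ δ ∈ Ioo (-ρ) ρ, δ ≠ 0 ∧ ∃ s ∈ Icc (0 : ℝ) 1, s * δ = t := by
      rcases lt_trichotomy t 0 with h | h | h
      · exact ⟨t, ht, h.ne, 1, by simp, one_mul t⟩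
      · exact ⟨ρ / 2, ⟨by linarith, by linarith⟩, by positivity, 0, by simp, by rw [h, zero_mul]⟩
      · exact ⟨t, ht, h.ne', 1, by simp, one_mul t⟩
    have h1 := hderiv δ hδ x hx s hs
    have h2 : HasDerivWithinAt (fun s : ℝ => u (s * δ, x) 1)
        (δ • deriv (fun t => u (t, x) 1) (s * δ)) (Icc 0 1) s :=
      (HasDerivAt.scomp (h := fun s : ℝ => s * δ) s hd.hasDerivAt
        (by simpa using (hasDerivAt_id s).mul_const δ)).hasDerivWithinAt
    have h3 := (uniqueDiffOn_Icc (zero_lt_one (α := ℝ)) s hs).eq_deriv _ h2 h1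
    have h4 := smul_right_injective E hδ0 h3
    rw [← h4]
    exact hd.hasDerivAt

/-- The local flow of a smooth vector field is smooth in time and initial value jointly. -/
theorem exists_smooth_flow [FiniteDimensional ℝ E] {f : E → E} {V : Set E} (hV : IsOpen V)
    (hf : ContDiffOn ℝ ∞ f V) {x₀ : E} (hx₀ : x₀ ∈ V) :
    ∃ Ψ : ℝ × E → E, ∃ ρ > 0,
      ∀ t ∈ Ioo (-ρ) ρ, ∀ x ∈ Metric.ball x₀ ρ, Ψ (0, x) = x ∧ Ψ (t, x) ∈ V ∧
        ContDiffAt ℝ ∞ Ψ (t, x) ∧ HasDerivAt (fun t => Ψ (t, x)) (f (Ψ (t, x))) t := by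
  obtain ⟨δ, hδ, hδV⟩ := Metric.isOpen_iff.1 hV x₀ hx₀
  -- The cut-off field is globally smooth and equals `f` on the ball of radius `δ / 3`; `ρ'` below
  -- keeps the flow in that ball.
  let χ : ContDiffBump x₀ := ⟨δ / 3, δ / 2, by positivity, by linarith⟩
  have hg : ContDiff ℝ ∞ (fun x => χ x • f x) := by
    rw [contDiff_iff_contDiffAt]
    intro x
    by_cases hx : x ∈ V
    · exact χ.contDiffAt.smul (hf.contDiffAt (hV.mem_nhds hx))
    · have hx' : x ∉ tsupport χ := fun h => hx (hδV (by
        rw [χ.tsupport_eq] at h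
        exact Metric.closedBall_subset_ball (show δ / 2 < δ by linarith) h))
      have h0 : (fun x => χ x • f x) =ᶠ[𝓝 x] fun _ => 0 := by
        filter_upwards [(isClosed_tsupport χ).isOpen_compl.mem_nhds hx'] with y hy
        rw [image_eq_zero_of_notMem_tsupport hy, zero_smul]
      exact contDiffAt_const.congr_of_eventuallyEq h0
  obtain ⟨Ψ, ρ, hρ, h0, h⟩ := exists_smooth_flow_of_contDiff hg x₀
  have hc : ContinuousAt Ψ (0, x₀) :=
    (h 0 ⟨by linarith, hρ⟩ x₀ (Metric.mem_ball_self hρ)).2.1.continuousAt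
  have hev : ∀ᶠ p in 𝓝 ((0 : ℝ), x₀), Ψ p ∈ Metric.ball x₀ (δ / 3) :=
    hc.eventually (by rw [h0]; exact Metric.ball_mem_nhds _ (by positivity))
  obtain ⟨ρ', hρ', hb⟩ := Metric.eventually_nhds_iff_ball.1 hev
  refine ⟨Ψ, min ρ ρ', lt_min hρ hρ', fun t ht x hx => ?_⟩
  have ht1 : t ∈ Ioo (-ρ) ρ := abs_lt.1 ((abs_lt.2 ht).trans_le (min_le_left _ _))
  have hx1 := Metric.ball_subset_ball (min_le_left ρ ρ') hx
  have hm : Ψ (t, x) ∈ Metric.ball x₀ (δ / 3) := by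
    refine hb _ ?_
    rw [← ball_prod_same]
    refine ⟨?_, Metric.ball_subset_ball (min_le_right ρ ρ') hx⟩
    rw [mem_ball_zero_iff]
    exact (abs_lt.2 ht).trans_le (min_le_right _ _)
  obtain ⟨h1, h2, h3⟩ := h t ht1 x hx1
  refine ⟨h1, hδV (Metric.ball_subset_ball (by linarith) hm), h2, ?_⟩
  rwa [χ.one_of_mem_closedBall (Metric.ball_subset_closedBall hm), one_smul] at h3

end Flow

/-! ### Directional derivatives of maps into a manifold -/

section Calculus

variable {N N' : Mfd.{u}} {P : Type} [NormedAddCommGroup P] [NormedSpace ℝ P]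

theorem isManifold_one (N : Mfd.{u}) : IsManifold N.model 1 N := IsManifold.of_le (n := ∞) (by simp)

theorem mem_extChartAt_tangent_source {w ξ : N.T} :
    ξ ∈ (extChartAt N.T.model w).source ↔ ξ.proj ∈ (extChartAt N.model w.proj).source := by
  rw [extChartAt_source, extChartAt_source]
  exact TangentBundle.mem_chart_source_iff ξ w

theorem mem_extChartAt_tangent_target {w : N.T} {z : N.E × N.E} :
    z ∈ (extChartAt N.T.model w).target ↔ z.1 ∈ (extChartAt N.model w.proj).target := by
  have h := TangentBundle.mem_chart_target_iff (I := N.model) (N.model.symm z.1, z.2) w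
  simp only [extChartAt, OpenPartialHomeomorph.extend_target, ModelWithCorners.range_eq_univ,
    inter_univ, mem_preimage]
  exact h

theorem extChartAt_tangent_apply {w ξ : N.T} (h : ξ.proj ∈ (extChartAt N.model w.proj).source) :
    extChartAt N.T.model w ξ = (extChartAt N.model w.proj ξ.proj,
      mfderiv N.model 𝓘(ℝ, N.E) (extChartAt N.model w.proj) ξ.proj ξ.snd) := by
  have := isManifold_one N
  rw [extChartAt_source] at h
  rw [(mdifferentiableAt_extChartAt h).mfderiv]
  rfl

/-- A directional derivative in the chart of the tangent bundle induced by a chart of the base. -/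
theorem extChartAt_dirDeriv {w : N.T} {γ : P → N} {p : P}
    (hγ : MDifferentiableAt 𝓘(ℝ, P) N.model γ p)
    (h : γ p ∈ (extChartAt N.model w.proj).source) (v : P) :
    extChartAt N.T.model w (dirDeriv v γ p) =
      (extChartAt N.model w.proj (γ p), fderiv ℝ (extChartAt N.model w.proj ∘ γ) p v) := by
  have := isManifold_one N
  have h' := h
  rw [extChartAt_source] at h'
  rw [extChartAt_tangent_apply h, ← mfderiv_eq_fderiv,
    mfderiv_comp p (mdifferentiableAt_extChartAt h') hγ]
  rfl

theorem extChartAt_tangent_injOn (w : N.T) {ξ η : N.T}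
    (hξ : ξ.proj ∈ (extChartAt N.model w.proj).source)
    (hη : η.proj ∈ (extChartAt N.model w.proj).source)
    (h : extChartAt N.T.model w ξ = extChartAt N.T.model w η) : ξ = η :=
  (extChartAt N.T.model w).injOn (mem_extChartAt_tangent_source.2 hξ)
    (mem_extChartAt_tangent_source.2 hη) h

theorem D_dirDeriv {f : N → N'} {γ : P → N} {p : P}
    (hf : MDifferentiableAt N.model N'.model f (γ p))
    (hγ : MDifferentiableAt 𝓘(ℝ, P) N.model γ p) (v : P) :
    D f (dirDeriv v γ p) = dirDeriv v (f ∘ γ) p := by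
  rw [dirDeriv, dirDeriv, mfderiv_comp p hf hγ]
  rfl

theorem dirDeriv_congr {γ γ' : P → N} {p : P} (h : γ =ᶠ[𝓝 p] γ') (v : P) :
    dirDeriv v γ p = dirDeriv v γ' p := by
  rw [dirDeriv, dirDeriv, h.mfderiv_eq, h.eq_of_nhds]

theorem smooth_proj (N : Mfd.{u}) : ContMDiff N.T.model N.model ∞ (proj N) :=
  Bundle.contMDiff_proj _

theorem contDiffAt_chart {γ : P → N} {p : P} {x : N} (h : γ p ∈ (extChartAt N.model x).source)
    (hs : ContMDiffAt 𝓘(ℝ, P) N.model ∞ γ p) : ContDiffAt ℝ ∞ (extChartAt N.model x ∘ γ) p := by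
  rw [extChartAt_source] at h
  exact contMDiffAt_iff_contDiffAt.1 ((contMDiffAt_iff_target_of_mem_source h).1 hs).2

theorem contMDiffAt_chart_symm {f : P → N.E} {p : P} {x : N}
    (h : f p ∈ (extChartAt N.model x).target) (hs : ContDiffAt ℝ ∞ f p) :
    ContMDiffAt 𝓘(ℝ, P) N.model ∞ ((extChartAt N.model x).symm ∘ f) p :=
  ((contMDiffOn_extChartAt_symm x).contMDiffAt
    ((isOpen_extChartAt_target x).mem_nhds h)).comp p (contMDiffAt_iff_contDiffAt.2 hs)

theorem eventually_mdifferentiableAt {γ : P → N} {p : P}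
    (h : ContMDiffAt 𝓘(ℝ, P) N.model ∞ γ p) :
    ∀ᶠ q in 𝓝 p, MDifferentiableAt 𝓘(ℝ, P) N.model γ q := by
  have := isManifold_one N
  filter_upwards [(contMDiffAt_iff_contMDiffAt_nhds (n := 1) (by simp)).1
    (h.of_le (m := 1) (by simp))] with q hq
  exact hq.mdifferentiableAt (by simp)

theorem eventually_mem_source {Y : Type*} [TopologicalSpace Y] {γ : Y → N} {p : Y}
    (h : ContinuousAt γ p) {x : N}
    (hx : γ p ∈ (extChartAt N.model x).source) :
    ∀ᶠ q in 𝓝 p, γ q ∈ (extChartAt N.model x).source :=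
  h.eventually ((isOpen_extChartAt_source x).mem_nhds hx)

theorem eventually_extChartAt_dirDeriv {w : N.T} {γ : P → N} {p : P}
    (hγ : ContMDiffAt 𝓘(ℝ, P) N.model ∞ γ p)
    (h : γ p ∈ (extChartAt N.model w.proj).source) (v : P) :
    (extChartAt N.T.model w ∘ dirDeriv v γ) =ᶠ[𝓝 p] fun q =>
      (extChartAt N.model w.proj (γ q), fderiv ℝ (extChartAt N.model w.proj ∘ γ) q v) := by
  filter_upwards [eventually_mdifferentiableAt hγ, eventually_mem_source hγ.continuousAt h]
    with q h1 h2
  exact extChartAt_dirDeriv h1 h2 v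

theorem contDiffAt_chart_dirDeriv {x : N} {γ : P → N} {p : P}
    (hγ : ContMDiffAt 𝓘(ℝ, P) N.model ∞ γ p)
    (h : γ p ∈ (extChartAt N.model x).source) (v : P) :
    ContDiffAt ℝ ∞ (fun q => fderiv ℝ (extChartAt N.model x ∘ γ) q v) p :=
  ((contDiffAt_chart h hγ).fderiv_right (m := ∞) (by simp)).clm_apply contDiffAt_const

theorem smoothAt_dirDeriv {γ : P → N} {p : P} (hγ : ContMDiffAt 𝓘(ℝ, P) N.model ∞ γ p) (v : P) :
    ContMDiffAt 𝓘(ℝ, P) N.T.model ∞ (dirDeriv v γ) p := by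
  set w : N.T := dirDeriv v γ p
  have h : γ p ∈ (extChartAt N.model w.proj).source := mem_extChartAt_source (γ p)
  have hs : ContDiffAt ℝ ∞ (fun q => (extChartAt N.model w.proj (γ q),
      fderiv ℝ (extChartAt N.model w.proj ∘ γ) q v)) p :=
    (contDiffAt_chart h hγ).prodMk (contDiffAt_chart_dirDeriv hγ h v)
  refine (contMDiffAt_chart_symm (N := N.T) (x := w) ?_ hs).congr_of_eventuallyEq ?_
  · exact mem_extChartAt_tangent_target.2 ((extChartAt N.model w.proj).map_source h)
  · filter_upwards [eventually_extChartAt_dirDeriv hγ h v, eventually_mem_source hγ.continuousAt h]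
      with q h1 h2
    rw [Function.comp_apply, ← h1, Function.comp_apply, PartialEquiv.left_inv]
    exact mem_extChartAt_tangent_source.2 h2

theorem dirDeriv_comp {Q : Type} [NormedAddCommGroup Q] [NormedSpace ℝ Q] {A : Q → P}
    {A' : Q →L[ℝ] P} {q : Q} {γ : P → N} (hγ : MDifferentiableAt 𝓘(ℝ, P) N.model γ (A q))
    (hA : HasFDerivAt A A' q) (v : Q) :
    dirDeriv v (γ ∘ A) q = dirDeriv (A' v) γ (A q) := by
  rw [dirDeriv, dirDeriv, mfderiv_comp q hγ hA.hasMFDerivAt.mdifferentiableAt,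
    hA.hasMFDerivAt.mfderiv]
  rfl

theorem velocity_comp {A : ℝ → P} {v : P} {t : ℝ} {γ : P → N}
    (hγ : MDifferentiableAt 𝓘(ℝ, P) N.model γ (A t)) (hA : HasDerivAt A v t) :
    velocity (γ ∘ A) t = dirDeriv v γ (A t) := by
  rw [velocity, dirDeriv_comp hγ hA.hasFDerivAt]
  simp

/-- Every smooth family of tangent vectors is the family of velocities of a smooth family of
curves. -/
theorem exists_family_of_velocities {g : P → N.T} {p₀ : P}
    (hg : ∀ᶠ p in 𝓝 p₀, ContMDiffAt 𝓘(ℝ, P) N.T.model ∞ g p) :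
    ∃ W : P × ℝ → N, (∀ᶠ q in 𝓝 (p₀, 0), ContMDiffAt 𝓘(ℝ, P × ℝ) N.model ∞ W q) ∧
      ∀ᶠ p in 𝓝 p₀, W (p, 0) = proj N (g p) ∧ dirDeriv (0, 1) W (p, 0) = g p := by
  set w := g p₀
  set φ := extChartAt N.model w.proj
  set G : P → N.E × N.E := extChartAt N.T.model w ∘ g
  -- Straight lines in the chart, starting at the base point with the given coordinate velocity.
  let f : P × ℝ → N.E := fun q => (G q.1).1 + q.2 • (G q.1).2
  have hsrc : ∀ᶠ p in 𝓝 p₀, (g p).proj ∈ φ.source := by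
    filter_upwards [eventually_mem_source (N := N.T) hg.self_of_nhds.continuousAt
      (mem_extChartAt_source w)] with p hp
    exact mem_extChartAt_tangent_source.1 hp
  have hG : ∀ᶠ p in 𝓝 p₀, ContDiffAt ℝ ∞ G p := by
    filter_upwards [hg, hsrc] with p h1 h2
    exact contDiffAt_chart (N := N.T) (mem_extChartAt_tangent_source.2 h2) h1
  have hf : ∀ q : P × ℝ, ContDiffAt ℝ ∞ G q.1 → ContDiffAt ℝ ∞ f q := fun q hq =>
    (contDiffAt_fst.comp q (hq.comp q contDiffAt_fst)).add
      (contDiffAt_snd.smul (contDiffAt_snd.comp q (hq.comp q contDiffAt_fst)))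
  have hG1 : ∀ p, (g p).proj ∈ φ.source → (G p).1 = φ (g p).proj := fun p hp => by
    change (extChartAt N.T.model w (g p)).1 = _
    rw [extChartAt_tangent_apply hp]
  have hf0 : ∀ p, (g p).proj ∈ φ.source → f (p, 0) = φ (g p).proj := fun p hp => by
    simp only [f, zero_smul, add_zero, hG1 p hp]
  have ht : ∀ᶠ q in 𝓝 (p₀, (0 : ℝ)), f q ∈ φ.target := by
    refine (hf (p₀, 0) hG.self_of_nhds).continuousAt.eventually
      ((isOpen_extChartAt_target w.proj).mem_nhds ?_)
    rw [hf0 p₀ hsrc.self_of_nhds]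
    exact φ.map_source hsrc.self_of_nhds
  refine ⟨φ.symm ∘ f, ?_, ?_⟩
  · have h1 : ∀ᶠ q : P × ℝ in 𝓝 (p₀, 0), ContDiffAt ℝ ∞ G q.1 := continuousAt_fst.eventually hG
    filter_upwards [ht, h1] with q h1 h2
    exact contMDiffAt_chart_symm h1 (hf q h2)
  · filter_upwards [hsrc, hG] with p h1 h2
    have h3 : f (p, 0) ∈ φ.target := by rw [hf0 p h1]; exact φ.map_source h1
    have h4 : (φ.symm ∘ f) (p, 0) = (g p).proj := by
      rw [Function.comp_apply, hf0 p h1, φ.left_inv h1]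
    refine ⟨h4, ?_⟩
    have h5 : (φ.symm ∘ f) (p, 0) ∈ φ.source := by rw [h4]; exact h1
    have h6 : ContMDiffAt 𝓘(ℝ, P × ℝ) N.model ∞ (φ.symm ∘ f) (p, 0) :=
      contMDiffAt_chart_symm h3 (hf (p, 0) h2)
    have h7 := h6.mdifferentiableAt (by simp)
    refine extChartAt_tangent_injOn w h5 h1 ?_
    rw [extChartAt_dirDeriv h7 h5]
    have h8 : (φ ∘ φ.symm ∘ f) =ᶠ[𝓝 (p, 0)] f := by
      filter_upwards [(hf (p, 0) h2).continuousAt.eventually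
        ((isOpen_extChartAt_target w.proj).mem_nhds h3)] with q hq
      exact φ.right_inv hq
    rw [h8.fderiv_eq, h4]
    have h9 : HasFDerivAt G (fderiv ℝ G p) p := (h2.differentiableAt (by simp)).hasFDerivAt
    have h10 : HasFDerivAt (fun q : P × ℝ => G q.1)
        ((fderiv ℝ G p).comp (ContinuousLinearMap.fst ℝ P ℝ)) (p, 0) :=
      HasFDerivAt.comp (p, (0 : ℝ)) (g := G) h9 hasFDerivAt_fst
    have h11 : HasFDerivAt f _ (p, 0) := h10.fst.add (hasFDerivAt_snd.smul h10.snd)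
    rw [h11.fderiv]
    refine Prod.ext ?_ ?_
    · exact (hG1 p h1).symm
    · simp [G]

end Calculus

/-! ### The canonical involution -/

section Kappa

variable {N : Mfd.{u}} {P : Type} [NormedAddCommGroup P] [NormedSpace ℝ P]

theorem chartAt_tangent_congr {w w' : N.T} (h : chartAt N.H w.proj = chartAt N.H w'.proj) :
    chartAt N.T.H w = chartAt N.T.H w' := by
  have h' : achart N.H w.proj = achart N.H w'.proj := Subtype.ext h
  have h1 := TangentBundle.chartAt (I := N.model) w
  have h2 := TangentBundle.chartAt (I := N.model) w'
  rw [h, h', ← h2] at h1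
  exact h1

/-- A tangent vector is stored in the preferred chart at its base point, so a chart of `TN` induced
by that same chart reads off the stored vector unchanged. -/
theorem extChartAt_tangent_of_proj_eq {w ξ : N.T} (h : chartAt N.H w.proj = chartAt N.H ξ.proj) :
    extChartAt N.T.model w ξ = (extChartAt N.model w.proj ξ.proj, ξ.snd) := by
  have := isManifold_one N
  rw [extChartAt, chartAt_tangent_congr h, ← extChartAt,
    extChartAt_tangent_apply (mem_extChartAt_source _)]
  refine Prod.ext ?_ ?_
  · simp only [extChartAt, h]
  · rw [← TangentBundle.continuousLinearMapAt_trivializationAt (mem_chart_source N.H ξ.proj),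
      TangentBundle.continuousLinearMapAt_trivializationAt_eq_core (mem_chart_source N.H ξ.proj)]
    exact (tangentBundleCore N.model N).coordChange_self _ _ (mem_chart_source N.H ξ.proj) _

theorem extChartAt_tangent_tangent {w ξ : N.T.T}
    (h : chartAt N.H w.proj.proj = chartAt N.H ξ.proj.proj) :
    extChartAt N.T.T.model w ξ =
      ((extChartAt N.model w.proj.proj ξ.proj.proj, ξ.proj.snd), ξ.snd) := by
  rw [extChartAt_tangent_of_proj_eq (N := N.T) (chartAt_tangent_congr h),
    extChartAt_tangent_of_proj_eq h]
  rfl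

theorem extChartAt_dirDeriv_dirDeriv {w : N.T.T} {V : P → N} {p : P}
    (hV : ContMDiffAt 𝓘(ℝ, P) N.model ∞ V p)
    (h : V p ∈ (extChartAt N.model w.proj.proj).source) (a b : P) :
    extChartAt N.T.T.model w (dirDeriv a (dirDeriv b V) p) =
      ((extChartAt N.model w.proj.proj (V p),
          fderiv ℝ (extChartAt N.model w.proj.proj ∘ V) p b),
        (fderiv ℝ (extChartAt N.model w.proj.proj ∘ V) p a,
          fderiv ℝ (fderiv ℝ (extChartAt N.model w.proj.proj ∘ V)) p a b)) := by
  have h1 := contDiffAt_chart h hV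
  have h2 : ContDiffAt ℝ ∞ (fderiv ℝ (extChartAt N.model w.proj.proj ∘ V)) p :=
    h1.fderiv_right (by simp)
  have h3 := (h2.differentiableAt (by simp)).hasFDerivAt.clm_apply (hasFDerivAt_const b p)
  have h4 := (h1.differentiableAt (by simp)).hasFDerivAt.prodMk h3
  rw [extChartAt_dirDeriv (N := N.T) ((smoothAt_dirDeriv hV b).mdifferentiableAt (by simp))
    (mem_extChartAt_tangent_source.2 h), (eventually_extChartAt_dirDeriv hV h b).fderiv_eq,
    extChartAt_dirDeriv (hV.mdifferentiableAt (by simp)) h]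
  refine Prod.ext rfl ?_
  refine (congrArg (fun L => L a) h4.fderiv).trans ?_
  simp

/-- The canonical involution interchanges the order of two derivatives. -/
theorem kappa_dirDeriv_dirDeriv {V : P → N} {p : P} (hV : ContMDiffAt 𝓘(ℝ, P) N.model ∞ V p)
    (a b : P) : kappa N (dirDeriv a (dirDeriv b V) p) = dirDeriv b (dirDeriv a V) p := by
  set w := dirDeriv b (dirDeriv a V) p
  set η := dirDeriv a (dirDeriv b V) p with hη
  have hs : V p ∈ (extChartAt N.model w.proj.proj).source := mem_extChartAt_source (V p)
  have h1 := extChartAt_dirDeriv_dirDeriv (w := w) hV hs a b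
  have h2 := extChartAt_dirDeriv_dirDeriv (w := w) hV hs b a
  -- All points involved lie over `V p`, so the stored components are the coordinates in the chart
  -- at `w` and `kappa` is literally the coordinate swap.
  have h3 := extChartAt_tangent_tangent (w := w) (ξ := η) rfl
  have h4 := extChartAt_tangent_tangent (w := w) (ξ := kappa N η) rfl
  have hsym : fderiv ℝ (fderiv ℝ (extChartAt N.model w.proj.proj ∘ V)) p a b =
      fderiv ℝ (fderiv ℝ (extChartAt N.model w.proj.proj ∘ V)) p b a :=
    ((contDiffAt_chart hs hV).isSymmSndFDerivAt (by simp; exact WithTop.coe_le_coe.2 le_top)).eq a b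
  have h6 := h3.symm.trans h1
  refine (extChartAt N.T.T.model w).injOn ?_ (mem_extChartAt_source w) ?_
  · exact mem_extChartAt_tangent_source.2 (mem_extChartAt_tangent_source.2 hs)
  · rw [h4, h2, ← hsym]
    have h5 : (η.snd : N.E × N.E) = _ := congrArg Prod.snd h6
    have h7 : (η.proj.snd : N.E) = _ := congrArg (fun z => z.1.2) h6
    have h8 : (η.snd : N.E × N.E).1 = _ := congrArg Prod.fst h5
    have h9 : (η.snd : N.E × N.E).2 = _ := congrArg Prod.snd h5
    exact Prod.ext (Prod.ext rfl h8) (Prod.ext h7 h9)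

theorem kappa_kappa (ξ : N.T.T) : kappa N (kappa N ξ) = ξ := rfl

/-- A vector tangent to `TN` is the velocity of a curve in `TN`, which in turn is a family of
velocities of curves in `N`. Identities for `kappa` thereby reduce to `kappa_dirDeriv_dirDeriv`. -/
theorem exists_dirDeriv_dirDeriv_eq (ξ : N.T.T) : ∃ V : ℝ × ℝ → N,
    ContMDiffAt 𝓘(ℝ, ℝ × ℝ) N.model ∞ V (0, 0) ∧
      dirDeriv (1, 0) (dirDeriv (0, 1) V) (0, 0) = ξ := by
  obtain ⟨W, hW, hW'⟩ := exists_family_of_velocities (N := N.T) (g := fun _ : ℝ => ξ) (p₀ := 0)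
    (Eventually.of_forall fun _ => contMDiffAt_const)
  have hA : ∀ t : ℝ, HasDerivAt (fun s : ℝ => ((0 : ℝ), s)) (0, 1) t := fun t =>
    (hasDerivAt_const t 0).prodMk (hasDerivAt_id t)
  have hAt : Tendsto (fun s : ℝ => ((0 : ℝ), s)) (𝓝 0) (𝓝 (0, 0)) := (hA 0).continuousAt
  have hB : HasDerivAt (fun s : ℝ => (s, (0 : ℝ))) (1, 0) 0 :=
    (hasDerivAt_id _).prodMk (hasDerivAt_const _ _)
  have hc : ∀ᶠ s in 𝓝 (0 : ℝ),
      ContMDiffAt 𝓘(ℝ, ℝ) N.T.model ∞ (W ∘ fun s : ℝ => ((0 : ℝ), s)) s := by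
    filter_upwards [hAt.eventually hW] with s hs
    exact hs.comp s (contMDiffAt_iff_contDiffAt.2 (by fun_prop))
  obtain ⟨V, hV, hV'⟩ := exists_family_of_velocities hc
  refine ⟨V, hV.self_of_nhds, ?_⟩
  have h1 := velocity_comp (γ := dirDeriv (0, 1) V) (A := fun s : ℝ => (s, (0 : ℝ))) (v := (1, 0))
    (t := 0) ((smoothAt_dirDeriv hV.self_of_nhds _).mdifferentiableAt (by simp)) hB
  rw [← h1]
  have h2 : (dirDeriv (0, 1) V ∘ fun s : ℝ => (s, (0 : ℝ))) =ᶠ[𝓝 0]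
      (W ∘ fun s : ℝ => ((0 : ℝ), s)) := by
    filter_upwards [hV'] with s hs using hs.2
  have h3 := velocity_comp (γ := W) (A := fun s : ℝ => ((0 : ℝ), s)) (v := (0, 1))
    (t := 0) (hW.self_of_nhds.mdifferentiableAt (by simp)) (hA 0)
  rw [velocity, dirDeriv_congr h2, ← velocity, h3]
  exact hW'.self_of_nhds.2

/-- The swap formula holds in every induced chart, not only in the preferred one used to define
`kappa`. A fixed chart around a point is what the proof of smoothness needs. -/
theorem extChartAt_kappa {w ξ : N.T.T} (h : ξ.proj.proj ∈ (extChartAt N.model w.proj.proj).source) :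
    extChartAt N.T.T.model w (kappa N ξ) =
      (((extChartAt N.T.T.model w ξ).1.1, (extChartAt N.T.T.model w ξ).2.1),
        ((extChartAt N.T.T.model w ξ).1.2, (extChartAt N.T.T.model w ξ).2.2)) := by
  obtain ⟨V, hV, rfl⟩ := exists_dirDeriv_dirDeriv_eq ξ
  have hs : V (0, 0) ∈ (extChartAt N.model w.proj.proj).source := h
  rw [kappa_dirDeriv_dirDeriv hV, extChartAt_dirDeriv_dirDeriv hV hs,
    extChartAt_dirDeriv_dirDeriv hV hs]
  have hsym : fderiv ℝ (fderiv ℝ (extChartAt N.model w.proj.proj ∘ V)) (0, 0) (0, 1) (1, 0) =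
      fderiv ℝ (fderiv ℝ (extChartAt N.model w.proj.proj ∘ V)) (0, 0) (1, 0) (0, 1) :=
    ((contDiffAt_chart hs hV).isSymmSndFDerivAt (by simp; exact WithTop.coe_le_coe.2 le_top)).eq _ _
  rw [hsym]

theorem smooth_kappa (N : Mfd.{u}) : ContMDiff N.T.T.model N.T.T.model ∞ (kappa N) := by
  intro w
  let swap : (N.E × N.E) × (N.E × N.E) → (N.E × N.E) × (N.E × N.E) :=
    fun z => ((z.1.1, z.2.1), (z.1.2, z.2.2))
  have hswap : ContDiff ℝ ∞ swap := by fun_prop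
  set φ := extChartAt N.T.T.model w
  have h1 : ContMDiffAt N.T.T.model 𝓘(ℝ, (N.E × N.E) × (N.E × N.E)) ∞ φ w := contMDiffAt_extChartAt
  have h2 := (contMDiff_iff_contDiff.2 hswap).contMDiffAt.comp w h1
  have h3 : swap (φ w) ∈ φ.target :=
    mem_extChartAt_tangent_target.2 (mem_extChartAt_tangent_target.2
      (mem_extChartAt_tangent_target.1 (mem_extChartAt_tangent_target.1
        (mem_extChartAt_target (I := N.T.T.model) w))))
  have h4 := ((contMDiffOn_extChartAt_symm (n := ∞) w).contMDiffAt
    ((isOpen_extChartAt_target w).mem_nhds h3)).comp w h2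
  refine h4.congr_of_eventuallyEq ?_
  filter_upwards [extChartAt_source_mem_nhds (I := N.T.T.model) w] with ξ hξ
  have hξ' := mem_extChartAt_tangent_source.1 (mem_extChartAt_tangent_source.1 hξ)
  have h5 := extChartAt_kappa hξ'
  change _ = φ.symm (swap (φ ξ))
  change _ = swap (φ ξ) at h5
  rw [← h5]
  exact (φ.left_inv (x := kappa N ξ)
    (mem_extChartAt_tangent_source.2 (mem_extChartAt_tangent_source.2 hξ'))).symm

/-- On `∂_a ∂_b V` both sides equal `∂_a V`. -/
theorem D_proj_eq_proj_kappa (ξ : N.T.T) : D (proj N) ξ = proj N.T (kappa N ξ) := by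
  obtain ⟨V, hV, rfl⟩ := exists_dirDeriv_dirDeriv_eq ξ
  rw [kappa_dirDeriv_dirDeriv hV, D_dirDeriv ((smooth_proj N).mdifferentiableAt (by simp))
    ((smoothAt_dirDeriv hV _).mdifferentiableAt (by simp))]
  rfl

end Kappa

/-! ### Integral curves on manifolds and smooth dependence on initial data -/

/-- Vectors over the same point are separated in a chart, the others by their base points.
Uniqueness of integral curves in iterated tangent bundles depends on this. -/
theorem t2Space_tangent (N : Mfd.{u}) [T2Space N] : T2Space N.T := by
  refine ⟨fun ξ η hne => ?_⟩
  by_cases hp : proj N ξ = proj N η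
  · set φ := extChartAt N.T.model ξ
    have hξ : ξ ∈ φ.source := mem_extChartAt_source ξ
    have hη : η ∈ φ.source := by
      refine mem_extChartAt_tangent_source.2 ?_
      rw [show η.proj = ξ.proj from hp.symm]
      exact mem_extChartAt_source _
    obtain ⟨A, B, hA, hB, hξA, hηB, hAB⟩ := t2_separation (fun h => hne (φ.injOn hξ hη h))
    have hc : ContinuousOn φ φ.source := continuousOn_extChartAt ξ
    have ho : IsOpen φ.source := isOpen_extChartAt_source ξ
    exact ⟨φ.source ∩ φ ⁻¹' A, φ.source ∩ φ ⁻¹' B, hc.isOpen_inter_preimage ho hA,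
      hc.isOpen_inter_preimage ho hB, ⟨hξ, hξA⟩, ⟨hη, hηB⟩,
      (hAB.preimage φ).mono inter_subset_right inter_subset_right⟩
  · exact separated_by_continuous (smooth_proj N).continuous hp

/-- `X` is a smooth vector field on the open set `U`. -/
structure IsVectorFieldOn {N : Mfd.{u}} (X : N → N.T) (U : Set N) : Prop where
  isOpen : IsOpen U
  smooth : ContMDiffOn N.model N.T.model ∞ X U
  proj_eq : ∀ x ∈ U, proj N (X x) = x

/-- `γ` is an integral curve, inside `U`, of the vector field `X`. -/
def IsIntegralCurveIn {N : Mfd.{u}} (X : N → N.T) (U : Set N) (γ : ℝ → N) (I : Set ℝ) : Prop :=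
  ∀ t ∈ I, MDifferentiableAt 𝓘(ℝ, ℝ) N.model γ t ∧ γ t ∈ U ∧ velocity γ t = X (γ t)

/-- `Φ` is a smooth family, with parameters in `O`, of integral curves of `X` on `I`. -/
def IsIntegralFamily {N : Mfd.{u}} {P : Type} [NormedAddCommGroup P] [NormedSpace ℝ P]
    (X : N → N.T) (U : Set N) (Φ : ℝ × P → N) (I : Set ℝ) (O : Set P) : Prop :=
  ∀ t ∈ I, ∀ s ∈ O, ContMDiffAt 𝓘(ℝ, ℝ × P) N.model ∞ Φ (t, s) ∧ Φ (t, s) ∈ U ∧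
    dirDeriv (1, 0) Φ (t, s) = X (Φ (t, s))

section Flow

variable {N : Mfd.{u}} {P : Type} [NormedAddCommGroup P] [NormedSpace ℝ P]
  {X : N → N.T} {U : Set N}

theorem hasDerivAt_slice (t : ℝ) (s : P) : HasDerivAt (fun t : ℝ => (t, s)) (1, 0) t :=
  (hasDerivAt_id t).prodMk (hasDerivAt_const t s)

theorem velocity_slice {Φ : ℝ × P → N} {t : ℝ} {s : P}
    (h : MDifferentiableAt 𝓘(ℝ, ℝ × P) N.model Φ (t, s)) :
    velocity (fun t => Φ (t, s)) t = dirDeriv (1, 0) Φ (t, s) :=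
  velocity_comp (γ := Φ) (A := fun t : ℝ => (t, s)) h (hasDerivAt_slice t s)

theorem contMDiffAt_slice {Φ : ℝ × P → N} {t : ℝ} {s : P}
    (h : ContMDiffAt 𝓘(ℝ, ℝ × P) N.model ∞ Φ (t, s)) :
    ContMDiffAt 𝓘(ℝ, ℝ) N.model ∞ (fun t => Φ (t, s)) t :=
  ContMDiffAt.comp (g := Φ) (f := fun t : ℝ => (t, s)) t h
    (contMDiffAt_iff_contDiffAt.2 (by fun_prop))

theorem contMDiffAt_param_slice {Φ : ℝ × P → N} {t : ℝ} {s : P}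
    (h : ContMDiffAt 𝓘(ℝ, ℝ × P) N.model ∞ Φ (t, s)) :
    ContMDiffAt 𝓘(ℝ, P) N.model ∞ (fun s => Φ (t, s)) s :=
  ContMDiffAt.comp (g := Φ) (f := fun s : P => (t, s)) s h
    (contMDiffAt_iff_contDiffAt.2 (by fun_prop))

theorem IsIntegralFamily.isIntegralCurveIn {Φ : ℝ × P → N} {I : Set ℝ} {O : Set P}
    (h : IsIntegralFamily X U Φ I O) {s : P} (hs : s ∈ O) :
    IsIntegralCurveIn X U (fun t => Φ (t, s)) I := fun t ht =>
  ⟨(contMDiffAt_slice (h t ht s hs).1).mdifferentiableAt (by simp), (h t ht s hs).2.1, by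
    rw [velocity_slice ((h t ht s hs).1.mdifferentiableAt (by simp)), (h t ht s hs).2.2]⟩

theorem IsIntegralCurveIn.mono {γ : ℝ → N} {I J : Set ℝ} (h : IsIntegralCurveIn X U γ J)
    (hIJ : I ⊆ J) : IsIntegralCurveIn X U γ I := fun t ht => h t (hIJ ht)

/-- Integral curves inside `U` which agree at one time agree. -/
theorem IsIntegralCurveIn.eqOn [T2Space N] (hX : IsVectorFieldOn X U) {α β : ℝ → N} {I : Set ℝ}
    (hI : IsOpenInterval I) (hα : IsIntegralCurveIn X U α I) (hβ : IsIntegralCurveIn X U β I)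
    {t₀ : ℝ} (ht₀ : t₀ ∈ I) (h : α t₀ = β t₀) : EqOn α β I := by
  have := isManifold_one N
  -- Taking fibre components gives a section everywhere; it represents `X` only on `U`, where `X x`
  -- lies over `x`.
  let v : (x : N) → TangentSpace N.model x := fun x => ((X x).snd : N.E)
  have hXv : ∀ x ∈ U, (⟨x, v x⟩ : N.T) = X x := fun x hx => by
    have h1 := hX.proj_eq x hx
    change (X x).proj = x at h1
    refine Bundle.TotalSpace.ext h1.symm ?_
    exact HEq.rfl
  have hint : ∀ γ : ℝ → N, IsIntegralCurveIn X U γ I → ∀ t ∈ I, IsMIntegralCurveAt γ v t := by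
    intro γ hγ t ht
    filter_upwards [hI.1.mem_nhds ht] with τ hτ
    obtain ⟨h1, h2, h3⟩ := hγ τ hτ
    have h4 : (mfderiv 𝓘(ℝ, ℝ) N.model γ τ (1 : ℝ) : N.E) = (v (γ τ) : N.E) :=
      congrArg (fun ξ : N.T => (ξ.snd : N.E)) h3
    have h5 : mfderiv 𝓘(ℝ, ℝ) N.model γ τ =
        (ContinuousLinearMap.smulRight (1 : ℝ →L[ℝ] ℝ) (v (γ τ))) := by
      refine ContinuousLinearMap.ext_ring ?_
      exact h4.trans (one_smul ℝ (v (γ τ) : N.E)).symm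
    rw [← h5]
    exact h1.hasMFDerivAt
  have hloc : ∀ t ∈ I, α t = β t → α =ᶠ[𝓝 t] β := fun t ht heq => by
    refine isMIntegralCurveAt_eventuallyEq_of_contMDiffAt_boundaryless ?_
      (hint α hα t ht) (hint β hβ t ht) heq
    have h1 := (hX.smooth.contMDiffAt (hX.isOpen.mem_nhds (hα t ht).2.1)).of_le
      (show (1 : WithTop ℕ∞) ≤ ∞ by simp)
    refine h1.congr_of_eventuallyEq ?_
    filter_upwards [hX.isOpen.mem_nhds (hα t ht).2.1] with x hx using hXv x hx
  have hconn : IsPreconnected I := hI.2.1.isPreconnected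
  -- Agreement is an open condition by local uniqueness, and so is disagreement by the Hausdorff
  -- property; connectedness of `I` concludes.
  refine fun t ht => (hconn.induction₂' (fun x y => α x = β x → α y = β y) ?_
    (fun x y z _ _ _ h1 h2 h3 => h2 (h1 h3)) ht₀ ht) h
  intro x hx
  by_cases hxe : α x = β x
  · filter_upwards [mem_nhdsWithin_of_mem_nhds (hloc x hx hxe)] with y hy
    exact ⟨fun _ => hy, fun _ => hxe⟩
  · have h1 : ∀ᶠ y in 𝓝 x, α y ≠ β y :=
      ((hα x hx).1.continuousAt.prodMk (hβ x hx).1.continuousAt).eventually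
        (isClosed_diagonal.isOpen_compl.mem_nhds hxe)
    filter_upwards [mem_nhdsWithin_of_mem_nhds h1] with y hy
    exact ⟨fun h => absurd h hxe, fun h => absurd h hy⟩

/-- This is the Euclidean flow transported by a chart. The time bound `δ` serves all initial points
in `O`. -/
theorem exists_local_flow (hX : IsVectorFieldOn X U) {x₀ : N} (hx₀ : x₀ ∈ U) :
    ∃ Φ : ℝ × N → N, ∃ δ > 0, ∃ O ∈ 𝓝 x₀, ∀ t ∈ Ioo (-δ) δ, ∀ x ∈ O,
      Φ (0, x) = x ∧ Φ (t, x) ∈ U ∧ velocity (fun t => Φ (t, x)) t = X (Φ (t, x)) ∧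
        ContMDiffAt (𝓘(ℝ, ℝ).prod N.model) N.model ∞ Φ (t, x) := by
  set φ := extChartAt N.model x₀
  let w : N.T := ⟨x₀, 0⟩
  let V : Set N.E := φ.target ∩ φ.symm ⁻¹' U
  have hV : IsOpen V :=
    (continuousOn_extChartAt_symm x₀).isOpen_inter_preimage (isOpen_extChartAt_target x₀) hX.isOpen
  let f : N.E → N.E := fun z => (extChartAt N.T.model w (X (φ.symm z))).2
  have hf : ContDiffOn ℝ ∞ f V := by
    intro z hz
    have h1 : ContMDiffAt 𝓘(ℝ, N.E) N.model ∞ (φ.symm ∘ id) z :=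
      contMDiffAt_chart_symm hz.1 contDiffAt_id
    have h2 : ContMDiffAt 𝓘(ℝ, N.E) N.T.model ∞ (X ∘ (φ.symm ∘ id)) z :=
      (hX.smooth.contMDiffAt (hX.isOpen.mem_nhds hz.2)).comp z h1
    have h3 := contDiffAt_chart (N := N.T) (x := w) (mem_extChartAt_tangent_source.2 (by
      change proj N (X (φ.symm z)) ∈ φ.source
      rw [hX.proj_eq _ hz.2]
      exact φ.map_target hz.1)) h2
    exact (contDiffAt_snd.comp z h3).contDiffWithinAt
  have hx₀V : φ x₀ ∈ V := ⟨mem_extChartAt_target x₀, by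
    rw [mem_preimage, extChartAt_to_inv]; exact hx₀⟩
  have : CompleteSpace N.E := FiniteDimensional.complete ℝ N.E
  obtain ⟨Ψ, ρ, hρ, hΨ⟩ := exists_smooth_flow hV hf hx₀V
  refine ⟨fun q => φ.symm (Ψ (q.1, φ q.2)), ρ, hρ, φ.source ∩ φ ⁻¹' Metric.ball (φ x₀) ρ,
    inter_mem (extChartAt_source_mem_nhds x₀)
      ((continuousAt_extChartAt x₀).preimage_mem_nhds (Metric.ball_mem_nhds _ hρ)), ?_⟩
  rintro t ht x ⟨hxs, hxb⟩
  obtain ⟨h1, h2, h3, h4⟩ := hΨ t ht _ hxb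
  have hsm : ContMDiffAt (𝓘(ℝ, ℝ).prod N.model) N.model ∞
      (fun q : ℝ × N => φ.symm (Ψ (q.1, φ q.2))) (t, x) := by
    have h5 : ContMDiffAt (𝓘(ℝ, ℝ).prod N.model) 𝓘(ℝ, N.E) ∞ (fun q : ℝ × N => φ q.2) (t, x) :=
      ContMDiffAt.comp (g := φ) (f := fun q : ℝ × N => q.2) (t, x)
        (contMDiffAt_extChartAt' (by rwa [extChartAt_source] at hxs)) contMDiffAt_snd
    have h6 : ContMDiffAt (𝓘(ℝ, ℝ).prod N.model) 𝓘(ℝ, ℝ × N.E) ∞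
        (fun q : ℝ × N => (q.1, φ q.2)) (t, x) := contMDiffAt_fst.prodMk_space h5
    exact ContMDiffAt.comp (g := φ.symm ∘ Ψ) (t, x) (contMDiffAt_chart_symm h2.1 h3) h6
  refine ⟨by simp only [h1, φ.left_inv hxs], h2.2, ?_, hsm⟩
  have h5 : φ.symm (Ψ (t, φ x)) ∈ φ.source := φ.map_target h2.1
  have h6 : ContMDiffAt 𝓘(ℝ, ℝ) N.model ∞ (fun t => φ.symm (Ψ (t, φ x))) t :=
    ContMDiffAt.comp (g := φ.symm ∘ Ψ) (f := fun t : ℝ => (t, φ x)) t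
      (contMDiffAt_chart_symm h2.1 h3) (contMDiffAt_iff_contDiffAt.2 (by fun_prop))
  have h7 : (φ ∘ fun t => φ.symm (Ψ (t, φ x))) =ᶠ[𝓝 t] fun t => Ψ (t, φ x) := by
    filter_upwards [h4.continuousAt.eventually
      ((isOpen_extChartAt_target x₀).mem_nhds h2.1)] with τ hτ
    exact φ.right_inv hτ
  have h8 : proj N (X (φ.symm (Ψ (t, φ x)))) = φ.symm (Ψ (t, φ x)) := hX.proj_eq _ h2.2
  have h9 : (X (φ.symm (Ψ (t, φ x)))).proj ∈ (extChartAt N.model w.proj).source := by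
    change proj N _ ∈ φ.source
    rwa [h8]
  refine extChartAt_tangent_injOn w h5 h9 ?_
  rw [velocity, extChartAt_dirDeriv (h6.mdifferentiableAt (by simp)) h5, h7.fderiv_eq]
  refine Prod.ext ?_ ?_
  · rw [extChartAt_tangent_apply h9]
    exact congrArg φ h8.symm
  · rw [h4.hasFDerivAt.fderiv]
    simp [f, φ]

theorem IsIntegralFamily.congr_at {Φ Φ' : ℝ × P → N} {p : ℝ × P} (h : Φ' =ᶠ[𝓝 p] Φ)
    (hΦ : ContMDiffAt 𝓘(ℝ, ℝ × P) N.model ∞ Φ p ∧ Φ p ∈ U ∧ dirDeriv (1, 0) Φ p = X (Φ p)) :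
    ContMDiffAt 𝓘(ℝ, ℝ × P) N.model ∞ Φ' p ∧ Φ' p ∈ U ∧ dirDeriv (1, 0) Φ' p = X (Φ' p) :=
  ⟨hΦ.1.congr_of_eventuallyEq h, by rw [h.eq_of_nhds]; exact hΦ.2.1, by
    rw [dirDeriv_congr h, h.eq_of_nhds]; exact hΦ.2.2⟩

/-- Near a time `τ` of an integral curve, initial data close to the curve are the initial data of
families of integral curves, on a time interval which does not depend on them. -/
theorem exists_short_integral_family (hX : IsVectorFieldOn X U) {J : Set ℝ} (hJ : IsOpen J)
    {γ : ℝ → N} (hγ : IsIntegralCurveIn X U γ J) {τ : ℝ} (hτ : τ ∈ J) :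
    ∃ η > 0, Ioo (τ - η) (τ + η) ⊆ J ∧ ∀ τ' ∈ Ioo (τ - η) (τ + η), ∀ (W : P → N) (s₀ : P),
      (∀ᶠ s in 𝓝 s₀, ContMDiffAt 𝓘(ℝ, P) N.model ∞ W s) → W s₀ = γ τ' →
      ∃ O : Set P, IsOpen O ∧ s₀ ∈ O ∧ ∃ Φ : ℝ × P → N, (∀ s ∈ O, Φ (τ', s) = W s) ∧
        IsIntegralFamily X U Φ (Ioo (τ - η) (τ + η)) O := by
  obtain ⟨F, δ, hδ, ON, hON, hF⟩ := exists_local_flow hX (hγ τ hτ).2.1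
  have h1 : ∀ᶠ t in 𝓝 τ, γ t ∈ interior ON :=
    (hγ τ hτ).1.continuousAt.eventually (isOpen_interior.mem_nhds (mem_interior_iff_mem_nhds.2 hON))
  obtain ⟨η₀, hη₀, hb⟩ := Metric.eventually_nhds_iff_ball.1 (h1.and (hJ.mem_nhds hτ))
  rw [Real.ball_eq_Ioo] at hb
  -- Two times in the interval of radius `η` differ by less than `δ`, so the local flow carries data
  -- from any of them to any other.
  set η := min η₀ (δ / 2)
  have hη : 0 < η := lt_min hη₀ (by positivity)
  have hηη : η ≤ η₀ := min_le_left _ _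
  have hηδ : η ≤ δ / 2 := min_le_right _ _
  have hsub : Ioo (τ - η) (τ + η) ⊆ Ioo (τ - η₀) (τ + η₀) :=
    Ioo_subset_Ioo (by linarith) (by linarith)
  refine ⟨η, hη, fun t ht => (hb t (hsub ht)).2, fun τ' hτ' W s₀ hW hW0 => ?_⟩
  have h2 : ∀ᶠ s in 𝓝 s₀, W s ∈ interior ON :=
    hW.self_of_nhds.continuousAt.eventually (isOpen_interior.mem_nhds (by
      rw [hW0]; exact (hb τ' (hsub hτ')).1))
  obtain ⟨O, hO, hOo, hs₀⟩ := eventually_nhds_iff.1 (hW.and h2)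
  have h0 : (0 : ℝ) ∈ Ioo (-δ) δ := ⟨by linarith, hδ⟩
  refine ⟨O, hOo, hs₀, fun q => F (q.1 - τ', W q.2), fun s hs => ?_, fun t ht s hs => ?_⟩
  · simpa using (hF 0 h0 _ (interior_subset (hO s hs).2)).1
  · have ht' : t - τ' ∈ Ioo (-δ) δ := by
      constructor <;> [have := ht.1; have := ht.2] <;> [have := hτ'.2; have := hτ'.1] <;> linarith
    obtain ⟨-, h3, h4, h5⟩ := hF _ ht' _ (interior_subset (hO s hs).2)
    have h6 : ContMDiffAt 𝓘(ℝ, ℝ × P) N.model ∞ (fun q : ℝ × P => F (q.1 - τ', W q.2)) (t, s) := by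
      refine ContMDiffAt.comp (g := F) (f := fun q : ℝ × P => (q.1 - τ', W q.2)) (t, s) h5
        (ContMDiffAt.prodMk (contMDiffAt_iff_contDiffAt.2 (by fun_prop)) ?_)
      exact ContMDiffAt.comp (g := W) (f := fun q : ℝ × P => q.2) (t, s) (hO s hs).1
        (contMDiffAt_iff_contDiffAt.2 (by fun_prop))
    refine ⟨h6, h3, ?_⟩
    rw [← velocity_slice (h6.mdifferentiableAt (by simp))]
    have h7 : ContMDiffAt 𝓘(ℝ, ℝ) N.model ∞ (fun t => F (t, W s)) (t - τ') :=
      ContMDiffAt.comp (g := F) (f := fun t : ℝ => (t, W s)) _ h5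
        (contMDiffAt_id.prodMk contMDiffAt_const)
    have h8 := velocity_comp (γ := fun t => F (t, W s)) (A := fun t => t - τ') (v := 1) (t := t)
      (h7.mdifferentiableAt (by simp)) ((hasDerivAt_id t).sub_const τ')
    exact h8.trans h4

/-- Smooth dependence on initial data along a compact piece of an integral curve. -/
theorem exists_integral_family [T2Space N] (hX : IsVectorFieldOn X U) {J : Set ℝ}
    (hJ : IsOpen J) {γ : ℝ → N} (hγ : IsIntegralCurveIn X U γ J) {a b : ℝ} (hab : a ≤ b)
    (hJab : Icc a b ⊆ J) {W : P → N} {s₀ : P}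
    (hW : ∀ᶠ s in 𝓝 s₀, ContMDiffAt 𝓘(ℝ, P) N.model ∞ W s) (hW0 : W s₀ = γ a) :
    ∃ I, IsOpenInterval I ∧ Icc a b ⊆ I ∧ I ⊆ J ∧ ∃ O : Set P, IsOpen O ∧ s₀ ∈ O ∧
      ∃ Φ : ℝ × P → N, (∀ s ∈ O, Φ (a, s) = W s) ∧ IsIntegralFamily X U Φ I O := by
  let Claim : ℝ → Prop := fun τ => ∃ I, IsOpenInterval I ∧ a ∈ I ∧ τ ∈ I ∧ I ⊆ J ∧
    ∃ O : Set P, IsOpen O ∧ s₀ ∈ O ∧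
      ∃ Φ : ℝ × P → N, (∀ s ∈ O, Φ (a, s) = W s) ∧ IsIntegralFamily X U Φ I O
  have hIoo : ∀ τ η : ℝ, 0 < η → IsOpenInterval (Ioo (τ - η) (τ + η)) := fun τ η hη =>
    ⟨isOpen_Ioo, ordConnected_Ioo, τ, by linarith, by linarith⟩
  have hbase : Claim a := by
    obtain ⟨η, hη, hηJ, h⟩ := exists_short_integral_family (P := P) hX hJ hγ
      (hJab (left_mem_Icc.2 hab))
    have ha : a ∈ Ioo (a - η) (a + η) := ⟨by linarith, by linarith⟩
    obtain ⟨O, hO, hs, Φ, hΦ, hΦ'⟩ := h a ha W s₀ hW hW0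
    exact ⟨_, hIoo a η hη, ha, ha, hηJ, O, hO, hs, Φ, hΦ, hΦ'⟩
  have hstep : ∀ τ ∈ Icc a b, ∃ η > 0, ∀ τ' ∈ Ioo (τ - η) (τ + η), ∀ τ'' ∈ Ioo (τ - η) (τ + η),
      Claim τ' → Claim τ'' := by
    intro τ hτ
    obtain ⟨η, hη, hηJ, h⟩ := exists_short_integral_family (P := P) hX hJ hγ (hJab hτ)
    refine ⟨η, hη, fun τ' hτ' τ'' hτ'' => ?_⟩
    rintro ⟨I₁, hI₁, ha₁, hτ₁, hIJ₁, O₁, hO₁, hs₁, Φ₁, hΦ₁, hfam₁⟩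
    -- The central member of the family is `γ` itself, so its data at `τ'` qualify for the
    -- short-time statement.
    have hcurve : EqOn (fun t => Φ₁ (t, s₀)) γ I₁ :=
      (hfam₁.isIntegralCurveIn hs₁).eqOn hX hI₁ (hγ.mono hIJ₁) ha₁ ((hΦ₁ s₀ hs₁).trans hW0)
    obtain ⟨O₂, hO₂, hs₂, Φ₂, hΦ₂, hfam₂⟩ := h τ' hτ' (fun s => Φ₁ (τ', s)) s₀
      (by filter_upwards [hO₁.mem_nhds hs₁] with s hs using
        contMDiffAt_param_slice (hfam₁ τ' hτ₁ s hs).1) (hcurve hτ₁)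
    set I₂ := Ioo (τ - η) (τ + η)
    have hI₂ : IsOpenInterval I₂ := hIoo τ η hη
    -- Both families have the same data at `τ'` and the overlap is an interval, so they coincide
    -- there and can be glued.
    have hagree : ∀ s ∈ O₁ ∩ O₂, EqOn (fun t => Φ₁ (t, s)) (fun t => Φ₂ (t, s)) (I₁ ∩ I₂) :=
      fun s hs => ((hfam₁.isIntegralCurveIn hs.1).mono inter_subset_left).eqOn hX
        ⟨hI₁.1.inter hI₂.1, hI₁.2.1.inter hI₂.2.1, τ', hτ₁, hτ'⟩
        ((hfam₂.isIntegralCurveIn hs.2).mono inter_subset_right) ⟨hτ₁, hτ'⟩ (hΦ₂ s hs.2).symm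
    classical
    let Φ : ℝ × P → N := fun q => if q.1 ∈ I₁ then Φ₁ q else Φ₂ q
    refine ⟨I₁ ∪ I₂, ⟨hI₁.1.union hI₂.1, ?_, τ', Or.inl hτ₁⟩, Or.inl ha₁, Or.inr hτ'',
      union_subset hIJ₁ hηJ, O₁ ∩ O₂, hO₁.inter hO₂, ⟨hs₁, hs₂⟩, Φ, ?_, ?_⟩
    · exact (IsPreconnected.union τ' hτ₁ hτ' hI₁.2.1.isPreconnected
        hI₂.2.1.isPreconnected).ordConnected
    · intro s hs
      simp only [Φ, if_pos ha₁]
      exact hΦ₁ s hs.1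
    · intro t ht s hs
      by_cases ht₁ : t ∈ I₁
      · refine IsIntegralFamily.congr_at ?_ (hfam₁ t ht₁ s hs.1)
        filter_upwards [continuousAt_fst.eventually (hI₁.1.mem_nhds ht₁)] with q hq
        exact if_pos hq
      · have ht₂ : t ∈ I₂ := ht.resolve_left ht₁
        refine IsIntegralFamily.congr_at ?_ (hfam₂ t ht₂ s hs.2)
        filter_upwards [continuousAt_fst.eventually (hI₂.1.mem_nhds ht₂),
          continuousAt_snd.eventually ((hO₁.inter hO₂).mem_nhds hs)] with q hq hq'
        by_cases hq₁ : q.1 ∈ I₁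
        · exact (if_pos hq₁).trans (hagree q.2 hq' ⟨hq₁, hq⟩)
        · exact if_neg hq₁
  have hb : Claim b := by
    -- Since `η` is independent of `τ'` and `τ''`, the claim passes in both directions between `x`
    -- and nearby times, hence from `a` to `b`.
    refine isPreconnected_Icc.induction₂' (fun x y => Claim x → Claim y) (fun x hx => ?_)
      (fun x y z _ _ _ h1 h2 h3 => h2 (h1 h3)) (left_mem_Icc.2 hab) (right_mem_Icc.2 hab) hbase
    obtain ⟨η, hη, h⟩ := hstep x hx
    have hxI : x ∈ Ioo (x - η) (x + η) := ⟨by linarith, by linarith⟩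
    filter_upwards [mem_nhdsWithin_of_mem_nhds (isOpen_Ioo.mem_nhds hxI)] with y hy
    exact ⟨h x hxI y hy, h y hy x hxI⟩
  obtain ⟨I, hI, ha, hbI, hIJ, h⟩ := hb
  exact ⟨I, hI, hI.2.1.out ha hbI, hIJ, h⟩

end Flow

/-! ### The tangent functor and naturality of the involution -/

section TangentMap

variable {N N' N'' : Mfd.{u}}

theorem D_comp_apply {g : N' → N''} {f : N → N'} (ξ : N.T)
    (hg : MDifferentiableAt N'.model N''.model g (f (proj N ξ)))
    (hf : MDifferentiableAt N.model N'.model f (proj N ξ)) :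
    D g (D f ξ) = D (g ∘ f) ξ :=
  (tangentMap_comp_at ξ hg hf).symm

theorem D_congr {f g : N → N'} {ξ : N.T} (h : f =ᶠ[𝓝 (proj N ξ)] g) : D f ξ = D g ξ := by
  have h1 : f ξ.proj = g ξ.proj := h.eq_of_nhds
  have h2 : mfderiv N.model N'.model f ξ.proj = mfderiv N.model N'.model g ξ.proj :=
    Filter.EventuallyEq.mfderiv_eq h
  rw [D, D, tangentMap, tangentMap, h1, h2]

theorem D_id (ξ : N.T) : D (id : N → N) ξ = ξ := by
  rw [D, tangentMap_id]
  rfl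

theorem proj_D (f : N → N') (ξ : N.T) : proj N' (D f ξ) = f (proj N ξ) := rfl

theorem smoothOn_D {f : N → N'} {U : Set N} (hU : IsOpen U)
    (hf : ContMDiffOn N.model N'.model ∞ f U) :
    ContMDiffOn N.T.model N'.T.model ∞ (D f) (proj N ⁻¹' U) := by
  have := isManifold_one N
  have := isManifold_one N'
  refine (hf.contMDiffOn_tangentMapWithin (m := ∞) (by simp) hU.uniqueMDiffOn).congr fun ξ hξ => ?_
  rw [D, tangentMapWithin, tangentMap, mfderivWithin_of_isOpen hU hξ]

theorem smooth_D {f : N → N'} (hf : ContMDiff N.model N'.model ∞ f) :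
    ContMDiff N.T.model N'.T.model ∞ (D f) := by
  have := isManifold_one N
  have := isManifold_one N'
  exact hf.contMDiff_tangentMap (by simp)

/-- The canonical involution is natural. -/
theorem D_D_kappa {f : N → N'} (hf : ContMDiff N.model N'.model ∞ f) (ξ : N.T.T) :
    D (D f) (kappa N ξ) = kappa N' (D (D f) ξ) := by
  obtain ⟨V, hV, rfl⟩ := exists_dirDeriv_dirDeriv_eq ξ
  have h : ∀ a b : ℝ × ℝ, D (D f) (dirDeriv a (dirDeriv b V) (0, 0)) =
      dirDeriv a (dirDeriv b (f ∘ V)) (0, 0) := fun a b => by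
    rw [D_dirDeriv ((smooth_D hf).mdifferentiableAt (by simp))
      ((smoothAt_dirDeriv hV b).mdifferentiableAt (by simp))]
    refine dirDeriv_congr ?_ a
    filter_upwards [eventually_mdifferentiableAt hV] with p hp
    exact D_dirDeriv (hf.mdifferentiableAt (by simp)) hp b
  rw [kappa_dirDeriv_dirDeriv hV, h, h, kappa_dirDeriv_dirDeriv (hf.contMDiffAt.comp _ hV)]

theorem proj_eq_D_proj_kappa (ξ : N.T.T) : D (proj N) (kappa N ξ) = proj N.T ξ := by
  rw [D_proj_eq_proj_kappa, kappa_kappa]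

end TangentMap

/-! ### Semisprays, families of geodesics and one complete lift -/

/-- `S` is a smooth second order vector field on the open set `U` of `TN`. -/
structure IsSemisprayOn {N : Mfd.{u}} (S : N.T → N.T.T) (U : Set N.T) : Prop where
  isVectorFieldOn : IsVectorFieldOn S U
  tangent_proj_eq : ∀ ξ ∈ U, D (proj N) (S ξ) = ξ

/-- `g` is a smooth family, with parameters in `O`, of geodesics of `S` on `I`, with velocities
in `U`. -/
def IsGeodesicFamily {N : Mfd.{u}} {P : Type} [NormedAddCommGroup P] [NormedSpace ℝ P]
    (S : N.T → N.T.T) (U : Set N.T) (g : ℝ × P → N) (I : Set ℝ) (O : Set P) : Prop :=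
  ∀ t ∈ I, ∀ p ∈ O, ContMDiffAt 𝓘(ℝ, ℝ × P) N.model ∞ g (t, p) ∧ dirDeriv (1, 0) g (t, p) ∈ U ∧
    dirDeriv (1, 0) (dirDeriv (1, 0) g) (t, p) = S (dirDeriv (1, 0) g (t, p))

section Lift

variable {N : Mfd.{u}} {P : Type} [NormedAddCommGroup P] [NormedSpace ℝ P]
  {S : N.T → N.T.T} {U : Set N.T}

theorem IsGeodesicFamily.isIntegralFamily {g : ℝ × P → N} {I : Set ℝ} {O : Set P}
    (hg : IsGeodesicFamily S U g I O) : IsIntegralFamily S U (dirDeriv (1, 0) g) I O :=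
  fun t ht p hp => ⟨smoothAt_dirDeriv (hg t ht p hp).1 _, (hg t ht p hp).2⟩

theorem IsSemisprayOn.mdifferentiableAt (hS : IsSemisprayOn S U) {ξ : N.T} (hξ : ξ ∈ U) :
    MDifferentiableAt N.T.model N.T.T.model S ξ :=
  (hS.isVectorFieldOn.smooth.contMDiffAt (hS.isVectorFieldOn.isOpen.mem_nhds hξ)).mdifferentiableAt
    (by simp)

theorem proj_kappa_mem {ξ : N.T.T} (hξ : ξ ∈ D (proj N) ⁻¹' U) : proj N.T (kappa N ξ) ∈ U := by
  rw [← D_proj_eq_proj_kappa]; exact hξ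

/-- The complete lift projects to the original semispray. -/
theorem D_D_proj_completeLift (S : N.T → N.T.T) (ξ : N.T.T) :
    D (D (proj N)) (completeLift N S ξ) = S (D (proj N) ξ) := by
  have h1 : D (proj N) ∘ kappa N = proj N.T := funext proj_eq_D_proj_kappa
  have h2 := D_comp_apply (g := D (proj N)) (f := kappa N) (kappa N.T (D S (kappa N ξ)))
    ((smooth_D (smooth_proj N)).mdifferentiableAt (by simp))
    ((smooth_kappa N).mdifferentiableAt (by simp))
  rw [h1, proj_eq_D_proj_kappa, proj_D, ← D_proj_eq_proj_kappa] at h2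
  exact h2

/-- Differentiating `π ∘ S = id` and `Dπ ∘ S = id` gives the corresponding identities for the lift:
`κ` turns `D(π)` into `π` in the first, and its naturality is used in the second. -/
theorem IsSemisprayOn.completeLift (hS : IsSemisprayOn S U) :
    IsSemisprayOn (completeLift N S) (D (proj N) ⁻¹' U) := by
  have hU := hS.isVectorFieldOn.isOpen
  have hDp := smooth_D (smooth_proj N)
  refine ⟨⟨hU.preimage hDp.continuous, ?_, fun ξ hξ => ?_⟩, fun ξ hξ => ?_⟩
  · have h1 : ContMDiffOn N.T.T.model N.T.T.T.model ∞ (D S ∘ kappa N) (D (proj N) ⁻¹' U) :=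
      (smoothOn_D hU hS.isVectorFieldOn.smooth).comp (smooth_kappa N).contMDiffOn
        fun ξ hξ => proj_kappa_mem hξ
    exact (smooth_D (smooth_kappa N)).comp_contMDiffOn ((smooth_kappa N.T).comp_contMDiffOn h1)
  · have hξ' := proj_kappa_mem hξ
    have h1 : proj N.T ∘ S =ᶠ[𝓝 (proj N.T (kappa N ξ))] id := by
      filter_upwards [hU.mem_nhds hξ'] with η hη using hS.isVectorFieldOn.proj_eq η hη
    have h2 := D_comp_apply (g := proj N.T) (f := S) (kappa N ξ)
      ((smooth_proj N.T).mdifferentiableAt (by simp)) (hS.mdifferentiableAt hξ')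
    rw [D_congr h1, D_id, D_proj_eq_proj_kappa] at h2
    change kappa N (proj N.T.T (kappa N.T (D S (kappa N ξ)))) = ξ
    rw [h2, kappa_kappa]
  · have hξ' := proj_kappa_mem hξ
    have h1 : D (proj N) ∘ S =ᶠ[𝓝 (proj N.T (kappa N ξ))] id := by
      filter_upwards [hU.mem_nhds hξ'] with η hη using hS.tangent_proj_eq η hη
    have h2 := D_comp_apply (g := D (proj N)) (f := S) (kappa N ξ)
      (hDp.mdifferentiableAt (by simp)) (hS.mdifferentiableAt hξ')
    rw [D_congr h1, D_id] at h2
    have h3 : proj N.T ∘ kappa N = D (proj N) := funext fun η => (D_proj_eq_proj_kappa η).symm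
    have h4 := D_comp_apply (g := proj N.T) (f := kappa N) (kappa N.T (D S (kappa N ξ)))
      ((smooth_proj N.T).mdifferentiableAt (by simp))
      ((smooth_kappa N).mdifferentiableAt (by simp))
    rw [h3, D_D_kappa (smooth_proj N), h2, kappa_kappa] at h4
    exact h4

/-- A parameter derivative of a family of geodesics of `S` is a family of geodesics of the complete
lift of `S`. -/
theorem IsGeodesicFamily.paramDeriv (hS : IsSemisprayOn S U) {g : ℝ × P → N} {I : Set ℝ} {O : Set P}
    (hI : IsOpen I) (hO : IsOpen O) (hg : IsGeodesicFamily S U g I O) (e : P) :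
    IsGeodesicFamily (completeLift N S) (D (proj N) ⁻¹' U) (dirDeriv (0, e) g) I O := by
  have hswap : ∀ t ∈ I, ∀ p ∈ O, dirDeriv (1, 0) (dirDeriv (0, e) g) (t, p) =
      kappa N (dirDeriv (0, e) (dirDeriv (1, 0) g) (t, p)) :=
    fun t ht p hp => (kappa_dirDeriv_dirDeriv (hg t ht p hp).1 _ _).symm
  intro t ht p hp
  obtain ⟨h1, h2, h3⟩ := hg t ht p hp
  have hnhds : I ×ˢ O ∈ 𝓝 (t, p) := prod_mem_nhds (hI.mem_nhds ht) (hO.mem_nhds hp)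
  refine ⟨smoothAt_dirDeriv h1 _, ?_, ?_⟩
  · rw [mem_preimage, hswap t ht p hp, proj_eq_D_proj_kappa]
    exact h2
  · have h4 : dirDeriv (1, 0) (dirDeriv (0, e) g) =ᶠ[𝓝 (t, p)]
        kappa N ∘ dirDeriv (0, e) (dirDeriv (1, 0) g) := by
      filter_upwards [hnhds] with q hq using hswap q.1 hq.1 q.2 hq.2
    have h5 : dirDeriv (1, 0) (dirDeriv (1, 0) g) =ᶠ[𝓝 (t, p)]
        S ∘ dirDeriv (1, 0) g := by
      filter_upwards [hnhds] with q hq using (hg q.1 hq.1 q.2 hq.2).2.2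
    have h6 := smoothAt_dirDeriv h1 ((1, 0) : ℝ × P)
    -- The `e`-derivative is moved outwards past both time derivatives, the geodesic equation is
    -- differentiated there, and one more exchange restores `∂_t ∂_e g`.
    rw [dirDeriv_congr h4, ← D_dirDeriv ((smooth_kappa N).mdifferentiableAt (by simp))
      ((smoothAt_dirDeriv h6 _).mdifferentiableAt (by simp)),
      ← kappa_dirDeriv_dirDeriv h6 (0, e) (1, 0), dirDeriv_congr h5,
      ← D_dirDeriv (hS.mdifferentiableAt h2) (h6.mdifferentiableAt (by simp)), hswap t ht p hp]
    rfl

/-- Projections of integral curves of a semispray are its geodesics. -/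
theorem IsIntegralFamily.isGeodesicFamily (hS : IsSemisprayOn S U) {Φ : ℝ × P → N.T} {I : Set ℝ}
    {O : Set P} (hI : IsOpen I) (hO : IsOpen O) (h : IsIntegralFamily S U Φ I O) :
    (∀ t ∈ I, ∀ p ∈ O, dirDeriv (1, 0) (proj N ∘ Φ) (t, p) = Φ (t, p)) ∧
      IsGeodesicFamily S U (proj N ∘ Φ) I O := by
  have h1 : ∀ t ∈ I, ∀ p ∈ O, dirDeriv (1, 0) (proj N ∘ Φ) (t, p) = Φ (t, p) := by
    intro t ht p hp
    obtain ⟨h1, h2, h3⟩ := h t ht p hp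
    rw [← D_dirDeriv ((smooth_proj N).mdifferentiableAt (by simp))
      (h1.mdifferentiableAt (by simp)), h3, hS.tangent_proj_eq _ h2]
  refine ⟨h1, fun t ht p hp => ?_⟩
  obtain ⟨h2, h3, h4⟩ := h t ht p hp
  refine ⟨(smooth_proj N).contMDiffAt.comp _ h2, by rwa [h1 t ht p hp], ?_⟩
  have h5 : dirDeriv (1, 0) (proj N ∘ Φ) =ᶠ[𝓝 (t, p)] Φ := by
    filter_upwards [prod_mem_nhds (hI.mem_nhds ht) (hO.mem_nhds hp)] with q hq using
      h1 q.1 hq.1 q.2 hq.2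
  rw [dirDeriv_congr h5, h1 t ht p hp, h4]

/-- A family of geodesics of the complete lift of `S` is, along compact intervals, a parameter
derivative of a family of geodesics of `S`. -/
theorem exists_geodesic_family_of_completeLift [T2Space N] (hS : IsSemisprayOn S U)
    {g : ℝ × P → N.T} {J : Set ℝ} {O' : Set P} (hJ : IsOpen J) (hO' : IsOpen O')
    (hg : IsGeodesicFamily (completeLift N S) (D (proj N) ⁻¹' U) g J O') {a b : ℝ} (hab : a ≤ b)
    (hJab : Icc a b ⊆ J) {p₀ : P} (hp₀ : p₀ ∈ O') :
    ∃ I, IsOpenInterval I ∧ Icc a b ⊆ I ∧ I ⊆ J ∧ ∃ O : Set (P × ℝ), IsOpen O ∧ (p₀, 0) ∈ O ∧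
      ∃ g₁ : ℝ × (P × ℝ) → N, IsGeodesicFamily S U g₁ I O ∧
        ∀ t ∈ I, ∀ p, (p, (0 : ℝ)) ∈ O → dirDeriv (0, (0, 1)) g₁ (t, (p, 0)) = g (t, p) := by
  have := t2Space_tangent N
  have := t2Space_tangent N.T
  have ha : a ∈ J := hJab (left_mem_Icc.2 hab)
  have hDp := smooth_D (smooth_proj N)
  -- These are the velocities of the projected curves `π ∘ g`, which are thus geodesics of `S`.
  have hc : IsIntegralFamily S U (D (proj N) ∘ dirDeriv (1, 0) g) J O' := by
    intro t ht p hp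
    obtain ⟨h1, h2, h3⟩ := hg t ht p hp
    have h4 := smoothAt_dirDeriv h1 ((1, 0) : ℝ × P)
    refine ⟨hDp.contMDiffAt.comp _ h4, h2, ?_⟩
    rw [← D_dirDeriv (hDp.mdifferentiableAt (by simp)) (h4.mdifferentiableAt (by simp)), h3,
      D_D_proj_completeLift]
    rfl
  -- Initial velocities of the variation sought: their derivative in the new parameter has to be
  -- `∂_s ∂_t` at time `a`, that is, `κ` of the prescribed `∂_t g`.
  obtain ⟨W, hW, hW'⟩ := exists_family_of_velocities (N := N.T) (p₀ := p₀)
    (g := fun p => kappa N (dirDeriv (1, 0) g (a, p))) (by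
      filter_upwards [hO'.mem_nhds hp₀] with p hp
      exact (smooth_kappa N).contMDiffAt.comp p
        (contMDiffAt_param_slice (smoothAt_dirDeriv (hg a ha p hp).1 _)))
  obtain ⟨O₂, hO₂, hO₂o, hp₀₂⟩ := eventually_nhds_iff.1 hW'
  obtain ⟨I, hI, hIab, hIJ, O₁, hO₁, hp₀₁, Φ, hΦa, hΦ⟩ := exists_integral_family
    hS.isVectorFieldOn hJ (hc.isIntegralCurveIn hp₀) hab hJab hW (by
      rw [hW'.self_of_nhds.1, ← D_proj_eq_proj_kappa]; rfl)
  obtain ⟨hvel, hgeo⟩ := hΦ.isGeodesicFamily hS hI.1 hO₁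
  have hlift := hgeo.paramDeriv hS hI.1 hO₁ (0, 1)
  refine ⟨I, hI, hIab, hIJ, O₁ ∩ (fun q : P × ℝ => q.1) ⁻¹' (O₂ ∩ O'),
    hO₁.inter ((hO₂o.inter hO').preimage continuous_fst), ⟨hp₀₁, hp₀₂, hp₀⟩, proj N ∘ Φ,
    fun t ht q hq => hgeo t ht q hq.1, ?_⟩
  rintro t ht p ⟨hpO₁, hpO₂, hpO'⟩
  have haI : a ∈ I := hIab (left_mem_Icc.2 hab)
  have hinit : dirDeriv (1, 0) (dirDeriv (0, (0, 1)) (proj N ∘ Φ)) (a, (p, 0))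
      = dirDeriv (1, 0) g (a, p) := by
    have h1 : dirDeriv (1, 0) (proj N ∘ Φ) =ᶠ[𝓝 (a, (p, (0 : ℝ)))] Φ := by
      filter_upwards [prod_mem_nhds (hI.1.mem_nhds haI) (hO₁.mem_nhds hpO₁)] with q hq using
        hvel q.1 hq.1 q.2 hq.2
    have h2 : (Φ ∘ fun s : P × ℝ => (a, s)) =ᶠ[𝓝 (p, (0 : ℝ))] W := by
      filter_upwards [hO₁.mem_nhds hpO₁] with s hs using hΦa s hs
    have h3 := dirDeriv_comp (γ := Φ) (A := fun s : P × ℝ => (a, s)) (q := (p, (0 : ℝ)))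
      ((hΦ a haI _ hpO₁).1.mdifferentiableAt (by simp)) (hasFDerivAt_prodMk_right a (p, (0 : ℝ)))
      (0, 1)
    rw [← kappa_dirDeriv_dirDeriv (hgeo a haI _ hpO₁).1, dirDeriv_congr h1]
    rw [dirDeriv_congr h2, (hO₂ p hpO₂).2] at h3
    simp only [ContinuousLinearMap.inr_apply] at h3
    rw [← h3, kappa_kappa]
  -- The time derivatives of the variation field and of `g` are integral curves of the lift with the
  -- same value at `a`.
  have heq := (hlift.isIntegralFamily.isIntegralCurveIn hpO₁).eqOn
    hS.completeLift.isVectorFieldOn hI ((hg.isIntegralFamily.isIntegralCurveIn hpO').mono hIJ)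
    haI hinit
  exact congrArg (proj N.T) (heq ht)

end Lift

/-! ### Slashed bundles and iterated lifts -/

theorem smooth_baseProj (M : Mfd.{u}) :
    ∀ r, ContMDiff (M.iter r).model M.model ∞ (baseProj M r)
  | 0 => contMDiff_id
  | r + 1 => (smooth_baseProj M r).comp (smooth_proj (M.iter r))

/-- The chain rule for `p_{r+1} = p_r ∘ π_r`. It matches the domains `D π ⁻¹' U` produced by the
complete lift. -/
theorem slashed_succ (M : Mfd.{u}) (r : ℕ) :
    slashed M (r + 1) = D (proj (M.iter r)) ⁻¹' slashed M r := by
  ext ξ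
  have h := D_comp_apply (g := baseProj M r) (f := proj (M.iter r)) ξ
    ((smooth_baseProj M r).mdifferentiableAt (by simp))
    ((smooth_proj (M.iter r)).mdifferentiableAt (by simp))
  change (D (baseProj M r ∘ proj (M.iter r)) ξ).snd ≠ 0 ↔
    (D (baseProj M r) (D (proj (M.iter r)) ξ)).snd ≠ 0
  rw [h]

theorem isOpen_slashed_zero (M : Mfd.{u}) : IsOpen (slashed M 0) := by
  have h0 : slashed M 0 = {ξ : M.T | (ξ.snd : M.E) ≠ 0} := by
    ext ξ
    have h : (D (id : M → M) ξ).snd = ξ.snd := by rw [D_id]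
    exact not_congr (by rw [← h]; rfl)
  rw [h0, isOpen_iff_mem_nhds]
  intro ξ hξ
  have h1 : ContinuousAt (fun η => (extChartAt M.T.model ξ η).2) ξ :=
    continuousAt_snd.comp (continuousAt_extChartAt ξ)
  have h2 : (extChartAt M.T.model ξ ξ).2 ≠ 0 := by
    rw [extChartAt_tangent_of_proj_eq rfl]; exact hξ
  filter_upwards [h1.eventually (isOpen_ne.mem_nhds h2),
    extChartAt_source_mem_nhds (I := M.T.model) ξ] with η h3 h4 h5
  refine h3 ?_
  rw [extChartAt_tangent_apply (mem_extChartAt_tangent_source.1 h4)]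
  have h6 : η.snd = 0 := h5
  simp only [h6]
  exact map_zero (mfderiv M.model 𝓘(ℝ, M.E) (extChartAt M.model ξ.proj) η.proj)

theorem isSemisprayOn_iterLift {M : Mfd.{u}} {S : M.T → M.T.T} (hS : IsSemispray M 0 S) :
    ∀ r, IsSemisprayOn (N := M.iter r) (iterLift M S r) (slashed M r)
  | 0 => ⟨⟨isOpen_slashed_zero M, hS.smooth, hS.proj_eq⟩, hS.tangent_proj_eq⟩
  | r + 1 => by
    rw [slashed_succ]
    exact (isSemisprayOn_iterLift hS r).completeLift

/-! ### Families of geodesics of the iterated lifts -/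

section Families

variable {P Q : Type} [NormedAddCommGroup P] [NormedSpace ℝ P] [NormedAddCommGroup Q]
  [NormedSpace ℝ Q]

theorem IsGeodesicFamily.isGeodesicOn {M : Mfd.{u}} {r : ℕ}
    {S : (M.iter r).T → (M.iter r).T.T} {g : ℝ × P → M.iter r} {I : Set ℝ} {O : Set P}
    (hI : IsOpenInterval I) (hg : IsGeodesicFamily S (slashed M r) g I O) {p : P} (hp : p ∈ O) :
    IsGeodesicOn M r S (fun t => g (t, p)) I := by
  have hv : ∀ t ∈ I, velocity (fun t => g (t, p)) t = dirDeriv (1, 0) g (t, p) := fun t ht =>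
    velocity_slice ((hg t ht p hp).1.mdifferentiableAt (by simp))
  refine ⟨hI, fun t ht => (contMDiffAt_slice (hg t ht p hp).1).contMDiffWithinAt, fun t ht => ?_,
    fun t ht => ?_⟩
  · rw [hv t ht]; exact (hg t ht p hp).2.1
  · have h1 : velocity (fun t => g (t, p)) =ᶠ[𝓝 t] fun t => dirDeriv (1, 0) g (t, p) := by
      filter_upwards [hI.1.mem_nhds ht] with τ hτ using hv τ hτ
    have h2 : velocity (velocity fun t => g (t, p)) t =
        velocity (fun t => dirDeriv (1, 0) g (t, p)) t := dirDeriv_congr h1 1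
    rw [h2, velocity_slice ((smoothAt_dirDeriv (hg t ht p hp).1 _).mdifferentiableAt (by simp)),
      hv t ht, (hg t ht p hp).2.2]

theorem isGeodesicFamily_of_isGeodesicOn {M : Mfd.{u}} {r : ℕ}
    {S : (M.iter r).T → (M.iter r).T.T} {g : ℝ × P → M.iter r} {I : Set ℝ} {O : Set P}
    (hs : ∀ t ∈ I, ∀ p ∈ O, ContMDiffAt 𝓘(ℝ, ℝ × P) (M.iter r).model ∞ g (t, p))
    (hg : ∀ p ∈ O, IsGeodesicOn M r S (fun t => g (t, p)) I) :
    IsGeodesicFamily S (slashed M r) g I O := by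
  intro t ht p hp
  have hI := (hg p hp).isOpenInterval
  have hv : ∀ t ∈ I, velocity (fun t => g (t, p)) t = dirDeriv (1, 0) g (t, p) := fun t ht =>
    velocity_slice ((hs t ht p hp).mdifferentiableAt (by simp))
  refine ⟨hs t ht p hp, ?_, ?_⟩
  · rw [← hv t ht]; exact (hg p hp).regular t ht
  · have h1 : velocity (fun t => g (t, p)) =ᶠ[𝓝 t] fun t => dirDeriv (1, 0) g (t, p) := by
      filter_upwards [hI.1.mem_nhds ht] with τ hτ using hv τ hτ
    have h2 : velocity (velocity fun t => g (t, p)) t =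
        velocity (fun t => dirDeriv (1, 0) g (t, p)) t := dirDeriv_congr h1 1
    rw [← velocity_slice ((smoothAt_dirDeriv (hs t ht p hp) _).mdifferentiableAt (by simp)),
      ← h2, (hg p hp).geodesic t ht, hv t ht]

theorem IsGeodesicFamily.comp_param {N : Mfd.{u}} {S : N.T → N.T.T} {U : Set N.T} {g : ℝ × P → N}
    {I : Set ℝ} {O : Set P} (hI : IsOpen I) (hO : IsOpen O) (hg : IsGeodesicFamily S U g I O)
    (ρ : Q →L[ℝ] P) :
    IsGeodesicFamily S U (g ∘ Prod.map id ρ) I (ρ ⁻¹' O) := by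
  let A : ℝ × Q →L[ℝ] ℝ × P := (ContinuousLinearMap.id ℝ ℝ).prodMap ρ
  have hA1 : A (1, 0) = (1, 0) := by simp [A]
  have hd : ∀ t ∈ I, ∀ q ∈ ρ ⁻¹' O,
      dirDeriv (1, 0) (g ∘ A) (t, q) = (dirDeriv (1, 0) g ∘ A) (t, q) := fun t ht q hq => by
    rw [dirDeriv_comp (A := A) (q := (t, q)) ((hg t ht _ hq).1.mdifferentiableAt (by simp))
      A.hasFDerivAt, hA1]
    rfl
  change IsGeodesicFamily S U (g ∘ A) I (ρ ⁻¹' O)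
  intro t ht q hq
  obtain ⟨h1, h2, h3⟩ := hg t ht _ hq
  have h4 : dirDeriv (1, 0) (g ∘ A) =ᶠ[𝓝 (t, q)] dirDeriv (1, 0) g ∘ A := by
    filter_upwards [prod_mem_nhds (hI.mem_nhds ht) ((hO.preimage ρ.continuous).mem_nhds hq)]
      with x hx using hd x.1 hx.1 x.2 hx.2
  refine ⟨ContMDiffAt.comp (g := g) (f := A) (t, q) h1
    (contMDiffAt_iff_contDiffAt.2 A.contDiff.contDiffAt), by rw [hd t ht q hq]; exact h2, ?_⟩
  rw [dirDeriv_congr h4, hd t ht q hq, dirDeriv_comp (A := A) (q := (t, q))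
    ((smoothAt_dirDeriv h1 _).mdifferentiableAt (by simp)) A.hasFDerivAt, hA1]
  exact h3

/-- The iterated derivative of a map in a sequence of directions; the last direction is applied
first. -/
noncomputable def iterDirDeriv {M : Mfd.{u}} (V : P → M) : (r : ℕ) → (Fin r → P) → P → M.iter r
  | 0, _ => V
  | r + 1, v => dirDeriv (v 0) (iterDirDeriv V r (Fin.tail v))

theorem smoothAt_iterDirDeriv {M : Mfd.{u}} {V : P → M} {p : P}
    (hV : ContMDiffAt 𝓘(ℝ, P) M.model ∞ V p) : ∀ (r : ℕ) (v : Fin r → P),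
      ContMDiffAt 𝓘(ℝ, P) (M.iter r).model ∞ (iterDirDeriv V r v) p
  | 0, _ => hV
  | r + 1, v => smoothAt_dirDeriv (smoothAt_iterDirDeriv hV r (Fin.tail v)) (v 0)

theorem mixedDeriv_eq_iterDirDeriv {M : Mfd.{u}} {k : ℕ} (V : ℝ × (Fin k → ℝ) → M) :
    ∀ (r : ℕ) (i : Fin r → Fin k), mixedDeriv V r i =
      iterDirDeriv V r fun l => ((0, Pi.single (i l) 1) : ℝ × (Fin k → ℝ))
  | 0, _ => rfl
  | r + 1, i => by
    rw [mixedDeriv, mixedDeriv_eq_iterDirDeriv V r (Fin.tail i)]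
    rfl

variable {M : Mfd.{u}} {S : M.T → M.T.T}

/-- Iterated parameter derivatives of families of geodesics are families of geodesics of the
iterated complete lifts. -/
theorem IsGeodesicFamily.iterParamDeriv (hS : IsSemispray M 0 S) {V : ℝ × P → M} {I : Set ℝ}
    {O : Set P} (hI : IsOpen I) (hO : IsOpen O) (hV : IsGeodesicFamily S (slashed M 0) V I O) :
    ∀ (r : ℕ) (e : Fin r → P), IsGeodesicFamily (N := M.iter r) (iterLift M S r) (slashed M r)
      (iterDirDeriv V r fun l => ((0, e l) : ℝ × P)) I O
  | 0, _ => hV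
  | r + 1, e => by
    rw [slashed_succ]
    exact (IsGeodesicFamily.iterParamDeriv hS hI hO hV r (Fin.tail e)).paramDeriv
      (isSemisprayOn_iterLift hS r) hI hO (e 0)

theorem t2Space_iter (M : Mfd.{u}) [T2Space M] : ∀ r, T2Space (M.iter r)
  | 0 => ‹_›
  | r + 1 => have := t2Space_iter M r; t2Space_tangent (M.iter r)

/-- Families of geodesics of an iterated complete lift are, along compact intervals, iterated
derivatives of families of geodesics. -/
theorem exists_geodesic_family_of_iterLift [T2Space M] (hS : IsSemispray M 0 S) {a b : ℝ}
    (hab : a ≤ b) (r : ℕ) :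
    ∀ {P Q : Type} [NormedAddCommGroup P] [NormedSpace ℝ P] [NormedAddCommGroup Q]
      [NormedSpace ℝ Q] {g : ℝ × P → M.iter r} {J : Set ℝ} {O' : Set P}, IsOpenInterval J →
      IsOpen O' → 0 ∈ O' → Icc a b ⊆ J →
      IsGeodesicFamily (N := M.iter r) (iterLift M S r) (slashed M r) g J O' →
      ∀ (ρ : Q →L[ℝ] P) (σ : Q →L[ℝ] (Fin r → ℝ)) (v : Fin r → Q),
        (∀ i, ρ (v i) = 0) → (∀ i, σ (v i) = Pi.single i 1) →
      ∃ I, IsOpenInterval I ∧ Icc a b ⊆ I ∧ I ⊆ J ∧ ∃ O : Set Q, IsOpen O ∧ 0 ∈ O ∧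
        ∃ V : ℝ × Q → M, IsGeodesicFamily S (slashed M 0) V I O ∧
          ∀ t ∈ I, ∀ q ∈ O, σ q = 0 →
            iterDirDeriv V r (fun i => ((0, v i) : ℝ × Q)) (t, q) = g (t, ρ q) := by
  -- Each step peels off the outermost derivative and adds a real parameter to `P`. The linear maps
  -- `ρ` and `σ` read the old parameters and the `r` new ones off a fixed space `Q`, so the nested
  -- products never appear in the result; `v` lists the directions of the new parameters.
  induction r with
  | zero =>
    intro P Q _ _ _ _ g J O' hJ hO' h0 hJab hg ρ σ v _ _
    exact ⟨J, hJ, hJab, subset_rfl, ρ ⁻¹' O', hO'.preimage ρ.continuous, by simpa using h0,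
      g ∘ Prod.map id ρ, hg.comp_param hJ.1 hO' ρ, fun _ _ _ _ _ => rfl⟩
  | succ r ih =>
    intro P Q _ _ _ _ g J O' hJ hO' h0 hJab hg ρ σ v hρ hσ
    have := t2Space_iter M r
    rw [slashed_succ] at hg
    obtain ⟨I₁, hI₁, hI₁ab, hI₁J, O₁, hO₁, h0₁, g₁, hg₁, hder⟩ :=
      exists_geodesic_family_of_completeLift (isSemisprayOn_iterLift hS r) hJ.1 hO' hg hab hJab h0
    -- The coordinate along `v 0`, the direction differentiated last, becomes an old parameter for
    -- the remaining `r` derivatives.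
    let ρ' : Q →L[ℝ] P × ℝ := ρ.prod ((ContinuousLinearMap.proj 0).comp σ)
    let σ' : Q →L[ℝ] (Fin r → ℝ) :=
      ContinuousLinearMap.pi fun i => (ContinuousLinearMap.proj i.succ).comp σ
    obtain ⟨I, hI, hIab, hII₁, O, hO, h0O, V, hV, hVg⟩ := ih hI₁ hO₁ h0₁ hI₁ab hg₁ ρ' σ'
      (Fin.tail v) (fun i => by simp [ρ', Fin.tail, hρ, hσ])
      (fun i => by ext l; simp [σ', Fin.tail, hσ, Pi.single_apply])
    refine ⟨I, hI, hIab, hII₁.trans hI₁J, O ∩ ρ' ⁻¹' O₁, hO.inter (hO₁.preimage ρ'.continuous),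
      ⟨h0O, by rw [mem_preimage, map_zero]; exact h0₁⟩, V, fun t ht q hq => hV t ht q hq.1, ?_⟩
    rintro t ht q ⟨hqO, hqO₁⟩ hσq
    have hρ'q : ρ' q = (ρ q, 0) := by simp [ρ', hσq]
    have hqO₁' : (ρ q, (0 : ℝ)) ∈ O₁ := by rw [← hρ'q]; exact hqO₁
    set F := iterDirDeriv V r fun i => ((0, Fin.tail v i) : ℝ × Q)
    have hF : ContMDiffAt 𝓘(ℝ, ℝ × Q) (M.iter r).model ∞ F (t, q) :=
      smoothAt_iterDirDeriv (hV t ht q hqO).1 r _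
    have hline : HasDerivAt (fun τ : ℝ => (t, q + τ • v 0)) (0, v 0) 0 := by
      refine (hasDerivAt_const _ _).prodMk ?_
      simpa using ((hasDerivAt_id (0 : ℝ)).smul_const (v 0)).const_add q
    have hline' : HasDerivAt (fun τ : ℝ => (t, (ρ q, τ))) (0, (0, 1)) 0 :=
      (hasDerivAt_const _ _).prodMk ((hasDerivAt_const _ _).prodMk (hasDerivAt_id _))
    have h1 := velocity_comp (γ := F) (A := fun τ : ℝ => (t, q + τ • v 0)) (t := 0)
      (by simpa using hF.mdifferentiableAt (by simp)) hline
    have h2 := velocity_comp (γ := g₁) (A := fun τ : ℝ => (t, (ρ q, τ))) (t := 0)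
      ((hg₁ t (hII₁ ht) _ hqO₁').1.mdifferentiableAt (by simp)) hline'
    -- Along this line `σ'` vanishes and `ρ'` equals `(ρ q, τ)`, so the inductive identity holds
    -- near `τ = 0` and can be differentiated.
    have h3 : (F ∘ fun τ : ℝ => (t, q + τ • v 0)) =ᶠ[𝓝 0] g₁ ∘ fun τ : ℝ => (t, (ρ q, τ)) := by
      have hc : ∀ᶠ τ : ℝ in 𝓝 0, q + τ • v 0 ∈ O := by
        have h4 : ContinuousAt (fun τ : ℝ => q + τ • v 0) 0 := by fun_prop
        exact h4.preimage_mem_nhds (hO.mem_nhds (by simpa using hqO))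
      filter_upwards [hc] with τ hτ
      have h4 := hVg t ht _ hτ (by ext l; simp [σ', hσ, hσq])
      refine h4.trans ?_
      simp [ρ', hρ, hσ, hσq]
    rw [velocity, dirDeriv_congr h3, ← velocity, h2] at h1
    simp only [zero_smul, add_zero] at h1
    exact h1.symm.trans (hder t (hII₁ ht) _ hqO₁')

end Families

/-! ### Cubes of parameters and the two halves of the theorem -/

theorem isOpen_cube (k : ℕ) (ε : ℝ) : IsOpen (cube k ε) := by
  have h : cube k ε = Set.pi univ fun _ => Ioo (-ε) ε := by ext s; simp [cube]
  rw [h]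
  exact isOpen_set_pi finite_univ fun _ _ => isOpen_Ioo

theorem zero_mem_cube {k : ℕ} {ε : ℝ} (hε : 0 < ε) : (0 : Fin k → ℝ) ∈ cube k ε :=
  fun _ => ⟨by simpa using hε, hε⟩

theorem exists_cube_subset {k : ℕ} {O : Set (Fin k → ℝ)} (hO : IsOpen O) (h0 : 0 ∈ O) :
    ∃ ε > 0, cube k ε ⊆ O := by
  obtain ⟨ε, hε, h⟩ := Metric.isOpen_iff.1 hO 0 h0
  refine ⟨ε, hε, fun s hs => h ?_⟩
  rw [mem_ball_zero_iff, pi_norm_lt_iff hε]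
  exact fun i => abs_lt.2 (hs i)

theorem isGeodesicOn_mixedDeriv {M : Mfd.{u}} {S : M.T → M.T.T} (hS : IsSemispray M 0 S) {k : ℕ}
    {c : ℝ → M} {I : Set ℝ} {ε : ℝ} {V : ℝ × (Fin k → ℝ) → M}
    (hV : IsGeodesicVariation M S k c I ε V) (r : ℕ) (i : Fin r → Fin k) :
    IsGeodesicOn M r (iterLift M S r) (fun t => mixedDeriv V r i (t, 0)) I := by
  have hI := hV.center_geodesic.isOpenInterval
  have hO := isOpen_cube k ε
  have hfam : IsGeodesicFamily S (slashed M 0) V I (cube k ε) :=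
    isGeodesicFamily_of_isGeodesicOn (r := 0)
      (fun t ht s hs => hV.smooth.contMDiffAt ((hI.1.prod hO).mem_nhds ⟨ht, hs⟩)) hV.geodesic
  have h := hfam.iterParamDeriv hS hI.1 hO r fun l => Pi.single (i l) 1
  rw [mixedDeriv_eq_iterDirDeriv]
  exact h.isGeodesicOn hI (zero_mem_cube hV.eps_pos)

theorem exists_isGeodesicVariation {M : Mfd.{u}} [T2Space M] {S : M.T → M.T.T}
    (hS : IsSemispray M 0 S) {r : ℕ} (hr : 1 ≤ r) {a b : ℝ} (hab : a ≤ b) {j : ℝ → M.iter r}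
    (hj : IsGeodesicOnIcc M r (iterLift M S r) j a b) :
    ∃ (c : ℝ → M) (I : Set ℝ) (ε : ℝ) (V : ℝ × (Fin r → ℝ) → M), Icc a b ⊆ I ∧
      IsGeodesicVariation M S r c I ε V ∧ ∀ t ∈ Icc a b, j t = mixedDeriv V r id (t, 0) := by
  obtain ⟨J, γ, hJ, hγ, hγj⟩ := hj
  -- The single geodesic is viewed as a family constant in a dummy real parameter, which `ρ = 0`
  -- discards below.
  have hfam : IsGeodesicFamily (N := M.iter r) (iterLift M S r) (slashed M r)
      (fun q : ℝ × ℝ => γ q.1) J univ := by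
    refine isGeodesicFamily_of_isGeodesicOn (fun t ht p _ => ?_) fun _ _ => hγ
    exact ContMDiffAt.comp (g := γ) (f := fun q : ℝ × ℝ => q.1) (t, p)
      (hγ.smooth.contMDiffAt (hγ.isOpenInterval.1.mem_nhds ht))
      (contMDiffAt_iff_contDiffAt.2 (by fun_prop))
  obtain ⟨I, hI, hIab, -, O, hO, h0, V, hV, hVg⟩ := exists_geodesic_family_of_iterLift hS hab r
    hγ.isOpenInterval isOpen_univ (mem_univ 0) hJ hfam (0 : (Fin r → ℝ) →L[ℝ] ℝ)
    (ContinuousLinearMap.id ℝ _) (fun i => Pi.single i 1) (fun _ => rfl) (fun _ => rfl)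
  obtain ⟨ε, hε, hεO⟩ := exists_cube_subset hO h0
  refine ⟨fun t => V (t, 0), I, ε, V, hIab, ⟨hr, hε, ?_, fun q hq => ?_, fun _ _ => rfl,
    fun s hs => ?_⟩, fun t ht => ?_⟩
  · exact IsGeodesicFamily.isGeodesicOn (r := 0) hI hV h0
  · exact (hV q.1 hq.1 q.2 (hεO hq.2)).1.contMDiffWithinAt
  · exact IsGeodesicFamily.isGeodesicOn (r := 0) hI hV (hεO hs)
  · rw [mixedDeriv_eq_iterDirDeriv]
    exact (hγj ht).symm.trans (hVg t (hIab ht) 0 h0 rfl).symm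

end JacobiLift

theorem mainTheorem1 (n : ℕ) (hn : 1 ≤ n) (M : Type u) [TopologicalSpace M] [T2Space M]
    [SecondCountableTopology M] [ChartedSpace (EuclideanSpace ℝ (Fin n)) M]
    [IsManifold (𝓡 n) ∞ M]
    (S : (JacobiLift.Mfd.of n M).T → (JacobiLift.Mfd.of n M).T.T)
    (hS : JacobiLift.IsSemispray (JacobiLift.Mfd.of n M) 0 S) (r : ℕ) (hr : 1 ≤ r) :
    (∀ (k : ℕ) (c : ℝ → M) (I : Set ℝ) (ε : ℝ) (V : ℝ × (Fin k → ℝ) → M),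
      JacobiLift.IsGeodesicVariation (JacobiLift.Mfd.of n M) S k c I ε V →
      ∀ i : Fin r → Fin k,
        JacobiLift.IsGeodesicOn (JacobiLift.Mfd.of n M) r
          (JacobiLift.iterLift (JacobiLift.Mfd.of n M) S r)
          (fun t => JacobiLift.mixedDeriv (M := JacobiLift.Mfd.of n M) V r i (t, 0)) I) ∧
    (∀ (a b : ℝ) (j : ℝ → (JacobiLift.Mfd.of n M).iter r), a ≤ b →
      JacobiLift.IsGeodesicOnIcc (JacobiLift.Mfd.of n M) r
        (JacobiLift.iterLift (JacobiLift.Mfd.of n M) S r) j a b →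
      ∃ (c : ℝ → M) (I' : Set ℝ) (ε : ℝ) (V : ℝ × (Fin r → ℝ) → M),
        Set.Icc a b ⊆ I' ∧
        JacobiLift.IsGeodesicVariation (JacobiLift.Mfd.of n M) S r c I' ε V ∧
        ∀ t ∈ Set.Icc a b,
          j t = JacobiLift.mixedDeriv (M := JacobiLift.Mfd.of n M) V r id (t, 0)) :=
  ⟨fun _ _ _ _ _ hV i => JacobiLift.isGeodesicOn_mixedDeriv hS hV r i,
    fun _ _ _ hab hj => JacobiLift.exists_isGeodesicVariation hS hr hab hj⟩
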